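/- A partition of $n$ with designated summands is an ordinary partition of $n$ in which, for each part size that occurs, exactly one of the parts of that size is tagged. Let $\mathrm{PDO}_t(n)$ be the total number of tagged parts over all partitions of $n$ with designated summands in which all parts are odd. For a positive integer $k$ let $$f_k:=\prod_{m=1}^{\infty}(1-q^{km}),$$ regarded as a formal power series in $q$ with integer coefficients (it has constant term $1$, hence is invertible). Then, as identities of formal power series with integer coefficients, $$\sum_{n=0}^{\infty}\mathrm{PDO}_t(8n+6)\,q^n=8\left(2\,\frac{f_2^{16}f_6^{10}}{f_1^{17}f_3^{3}f_{12}^{4}}-q\,\frac{f_2^{28}f_3f_{12}^{4}}{f_1^{21}f_6^{2}f_4^{8}}-16q^2\,\frac{f_2^{4}f_3f_4^{8}f_{12}^{4}}{f_1^{13}f_6^{2}}\right)$$ and $$\sum_{n=0}^{\infty}\mathrm{PDO}_t(8n+7)\,q^n=8\left(\frac{f_2^{14}f_3f_6^{4}f_8^{2}}{f_1^{14}f_4^{3}f_{12}^{2}}+2\,\frac{f_2^{9}f_3^{2}f_4^{5}f_6}{f_1^{13}f_8^{2}}+4q\,\frac{f_2^{8}f_3^{3}f_4f_8^{2}f_{12}^{2}}{f_1^{12}f_6^{2}}\right).$$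 In particular, for every integer $n\ge 0$, $$\mathrm{PDO}_t(8n+6)\equiv 0\pmod 8\qquad\text{and}\qquad \mathrm{PDO}_t(8n+7)\equiv 0\pmod 8 .$$ -/

import Mathlib

open PowerSeries
open scoped PowerSeries.WithPiTopology

/-- A partition of `n` with designated summands: an ordinary partition of `n` in which, for every
part size `i` that occurs, exactly one of the `count i` occurrences of `i` is tagged
(`tag i` is the position of the tagged one among the equal parts `i`). -/
def DesignatedPartition (n : ℕ) : Type :=
  Σ p : n.Partition, ∀ i : p.parts.toFinset, Fin (p.parts.count (i : ℕ))

instance (n : ℕ) : Fintype (DesignatedPartition n) :=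
  inferInstanceAs
    (Fintype (Σ p : n.Partition, ∀ i : p.parts.toFinset, Fin (p.parts.count (i : ℕ))))

namespace DesignatedPartition

/-- The multiset of parts of a partition with designated summands. -/
def parts {n : ℕ} (d : DesignatedPartition n) : Multiset ℕ := d.1.parts

/-- The tagged parts: the pairs (part size, position of the tagged occurrence). -/
def taggedParts {n : ℕ} (d : DesignatedPartition n) : Finset (ℕ × ℕ) :=
  Finset.univ.image fun i : d.1.parts.toFinset => ((i : ℕ), (d.2 i : ℕ))

/-- The number of tagged parts is the number of different part sizes. -/
theorem card_taggedParts {n : ℕ} (d : DesignatedPartition n) :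
    d.taggedParts.card = d.parts.toFinset.card := by
  unfold taggedParts parts
  rw [Finset.card_image_of_injective]
  · simp
  · intro i j h
    exact Subtype.ext (Prod.ext_iff.mp h).1

end DesignatedPartition

/-- `PDOt n` is the total number of tagged parts over all partitions of `n` with designated
summands in which all parts are odd. -/
def PDOt (n : ℕ) : ℕ :=
  ∑ d : DesignatedPartition n with (∀ i ∈ d.parts, Odd i), d.taggedParts.card

/-- The formal power series `∏_{m ≥ 1} (1 - q ^ (k m))`; the infinite product is taken in the
topology of coefficientwise convergence. -/
noncomputable def eulerSeries (k : ℕ+) : ℤ⟦X⟧ :=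
  ∏' m : ℕ, (1 - (X : ℤ⟦X⟧) ^ ((k : ℕ) * (m + 1)))

theorem multipliable_eulerSeries (k : ℕ+) :
    Multipliable fun m : ℕ => (1 - (X : ℤ⟦X⟧) ^ ((k : ℕ) * (m + 1))) := by
  simp_rw [sub_eq_add_neg]
  apply PowerSeries.WithPiTopology.multipliable_one_add_of_tendsto_order_atTop_nhds_top
  refine ENat.tendsto_nhds_top_iff_natCast_lt.mpr fun n =>
    Filter.eventually_atTop.mpr ⟨n, fun m hm => ?_⟩
  rw [order_neg, order_X_pow]
  exact_mod_cast lt_of_lt_of_le (Nat.lt_succ_of_le hm) (Nat.le_mul_of_pos_left _ k.pos)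

theorem constantCoeff_eulerSeries (k : ℕ+) : constantCoeff (eulerSeries k) = 1 := by
  rw [eulerSeries, (multipliable_eulerSeries k).map_tprod _
    (PowerSeries.WithPiTopology.continuous_constantCoeff ℤ)]
  simp

/-- `f_k = ∏_{m ≥ 1} (1 - q ^ (k m))`, as an invertible formal power series with integer
coefficients, so that quotients of products of the `f_k` are literal quotients in the group of
units of `ℤ⟦X⟧`. -/
noncomputable def eulerF (k : ℕ+) : ℤ⟦X⟧ˣ :=
  (PowerSeries.isUnit_iff_constantCoeff.mpr
    (by rw [constantCoeff_eulerSeries k]; exact isUnit_one) : IsUnit (eulerSeries k)).unit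

/-- The underlying power series of `eulerF k`. -/
theorem coe_eulerF (k : ℕ+) : (eulerF k : ℤ⟦X⟧) = eulerSeries k := IsUnit.unit_spec _

local notation "f[" k "]" => eulerF k

/-! Write φ(q) = ∑ q^(n²) and ψ(q) = ∑_{n ≥ 0} q^(n(n+1)/2); here `theta 1 1 1` is φ(q), `theta (-1)
1 1` is φ(-q) and `theta 1 1 0` is 2ψ(q).

If each occurring part size has weight z, an odd size i contributes 1 + z x/(1-x)² with x = q^i. For
z = u + u⁻¹ + 2 this is (1+ux)(1+x/u)/(1-x)², so the triple product turns the generating function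
into f_2/f_1² times ∑ u^n q^(n²). The total number of tags is the z-derivative at z = 1, where u is
a primitive cube root of unity w. The derivative is taken algebraically, over the dual numbers, with
u = w(1+ε). Pairing n with -n leaves q ∑ (3n+1) q^(3(3n²+2n)), and ∑ (3n+1) q^(3n²+2n) = φ(-q) f_4²
(`theta_neg_one_mul_eulerProd_four_cube`). Hence ∑ PDO_t(n) q^n = q f_2 f_3² f_12²/(f_1² f_6)
(`series_PDOt_mul_eulerProd`).

The progressions mod 8 come from three successive 2-dissections, using the even and odd parts of
f_3²/f_1², f_3/f_1³, f_3³/f_1, 1/f_1² and 1/f_1⁴. Those of 1/f_1² and 1/f_1⁴ come from splitting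
φ(q) and φ(q)² by parity, that of f_3²/f_1² from splitting φ(q)φ(-q³). The other two rest on one
parameter P = `levelP`: four Euler quotients of level twelve equal 1+P, 1-P, 2+P and 1+2P
(`levelE_eq`, `levelG_eq`, `levelH_eq`, `levelM_eq`). The value 1-P needs the cubic identity
`theta_cube_sub_theta_cube`, a norm over cube roots of unity.

The last dissection yields four products each time. Two are proportional and merge; the remaining
pair is brought to the stated shape by rational identities in P. The common factor 8 gives the
congruences. -/

/-! ### Families of power series tending to zero, and equality modulo all powers of X -/

section Order

variable {R : Type*} [CommRing R]

/-- A family of power series all but finitely many of whose members are divisible by any given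
power of the variable. -/
def OrderTendsto {ι : Type*} (f : ι → R⟦X⟧) : Prop := ∀ d : ℕ, {i | ¬ (X : R⟦X⟧) ^ d ∣ f i}.Finite

theorem OrderTendsto.mul {ι κ : Type*} {f : ι → R⟦X⟧} {g : κ → R⟦X⟧} (hf : OrderTendsto f)
    (hg : OrderTendsto g) : OrderTendsto fun x : ι × κ => f x.1 * g x.2 := by
  intro d
  refine ((hf d).prod (hg d)).subset fun x hx => ⟨fun h => hx (h.mul_right _), fun h => hx (h.mul_left _)⟩

theorem OrderTendsto.comp_injective {ι κ : Type*} {f : ι → R⟦X⟧} (hf : OrderTendsto f) {g : κ → ι}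
    (hg : Function.Injective g) : OrderTendsto (f ∘ g) := fun d => (hf d).preimage hg.injOn

theorem OrderTendsto.mul_left {ι : Type*} {f : ι → R⟦X⟧} (hf : OrderTendsto f) (g : ι → R⟦X⟧) :
    OrderTendsto fun i => g i * f i := fun d => (hf d).subset fun _ hi h => hi (h.mul_left _)

theorem OrderTendsto.of_finite {ι : Type*} {e : ι → ℕ} (he : ∀ d, {i | e i < d}.Finite)
    (c : ι → R⟦X⟧) : OrderTendsto fun i => c i * X ^ e i := by
  refine fun d => (he d).subset fun i hi => ?_
  by_contra h
  exact hi ((pow_dvd_pow X (not_lt.mp h)).mul_left _)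

theorem X_pow_dvd_sub_one_mul {d : ℕ} {a b : R⟦X⟧} (ha : X ^ d ∣ a - 1) (hb : X ^ d ∣ b - 1) :
    X ^ d ∣ a * b - 1 := by
  have : a * b - 1 = a * (b - 1) + (a - 1) := by ring
  rw [this]
  exact dvd_add (hb.mul_left _) ha

theorem eq_of_forall_X_pow_dvd_sub {a b : R⟦X⟧} (h : ∀ d : ℕ, X ^ d ∣ a - b) : a = b := by
  refine PowerSeries.ext fun n => ?_
  have := X_pow_dvd_iff.mp (h (n + 1)) n n.lt_succ_self
  rwa [map_sub, sub_eq_zero] at this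

end Order

/-! ### Sums and products in the topology of coefficientwise convergence -/

section Topology

variable {R : Type*} [CommRing R] [TopologicalSpace R]

theorem OrderTendsto.summable {ι : Type*} {f : ι → R⟦X⟧} (hf : OrderTendsto f) : Summable f := by
  refine (WithPiTopology.summable_iff_summable_coeff _).mpr fun n =>
    summable_of_hasFiniteSupport ((hf (n + 1)).subset fun i hi h => hi ?_)
  exact X_pow_dvd_iff.mp h n (Nat.lt_succ_self n)

theorem HasSum.mul_of_orderTendsto [IsTopologicalRing R] [T2Space R] {ι κ : Type*} {f : ι → R⟦X⟧}
    {g : κ → R⟦X⟧} {a b : R⟦X⟧} (ha : HasSum f a) (hb : HasSum g b) (hf : OrderTendsto f)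
    (hg : OrderTendsto g) : HasSum (fun x : ι × κ => f x.1 * g x.2) (a * b) :=
  ha.mul hb (hf.mul hg).summable

theorem HasSum.X_pow_dvd [T2Space R] {ι : Type*} {f : ι → R⟦X⟧} {a : R⟦X⟧} (ha : HasSum f a)
    {d : ℕ} (h : ∀ i, (X : R⟦X⟧) ^ d ∣ f i) : (X : R⟦X⟧) ^ d ∣ a := by
  refine X_pow_dvd_iff.mpr fun m hm => ?_
  have h1 := (WithPiTopology.hasSum_iff_hasSum_coeff R).mp ha m
  have h2 : (fun i => coeff m (f i)) = fun _ => 0 := funext fun i => X_pow_dvd_iff.mp (h i) m hm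
  rw [h2] at h1
  exact h1.unique hasSum_zero

theorem HasProd.X_pow_dvd_sub_one [T2Space R] {ι : Type*} {f : ι → R⟦X⟧} {a : R⟦X⟧}
    (ha : HasProd f a) {d : ℕ} (h : ∀ i, (X : R⟦X⟧) ^ d ∣ f i - 1) : (X : R⟦X⟧) ^ d ∣ a - 1 := by
  classical
  refine X_pow_dvd_iff.mpr fun m hm => ?_
  have h1 : ∀ s : Finset ι, X ^ d ∣ ∏ i ∈ s, f i - 1 := by
    intro s
    induction s using Finset.induction_on with
    | empty => simp
    | insert i s hi ih =>
      rw [Finset.prod_insert hi]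
      exact X_pow_dvd_sub_one_mul (h i) ih
  have h2 := (WithPiTopology.tendsto_iff_coeff_tendsto R _ _ _).mp ha m
  rw [map_sub, sub_eq_zero]
  refine tendsto_nhds_unique h2 ?_
  refine tendsto_const_nhds.congr fun s => ?_
  have := X_pow_dvd_iff.mp (h1 s) m hm
  rw [map_sub, sub_eq_zero] at this
  exact this.symm

theorem multipliable_one_add_mul_X_pow (c : R⟦X⟧) {k : ℕ} (hk : 0 < k) (i : ℕ) :
    Multipliable fun m : ℕ => 1 + c * (X : R⟦X⟧) ^ (i + k * m) := by
  nontriviality R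
  apply WithPiTopology.multipliable_one_add_of_tendsto_order_atTop_nhds_top
  refine ENat.tendsto_nhds_top_iff_natCast_lt.mpr fun n =>
    Filter.eventually_atTop.mpr ⟨n + 1, fun m hm => ?_⟩
  refine lt_of_lt_of_le ?_ (le_order_mul _ _)
  rw [order_X_pow]
  refine lt_of_lt_of_le ?_ le_add_self
  have : m ≤ k * m := Nat.le_mul_of_pos_left _ hk
  exact_mod_cast (by omega : n < i + k * m)

theorem multipliable_one_sub_X_pow_add {k : ℕ} (hk : 0 < k) (i : ℕ) :
    Multipliable fun m : ℕ => 1 - (X : R⟦X⟧) ^ (i + k * m) := by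
  simpa [sub_eq_add_neg] using multipliable_one_add_mul_X_pow (-1 : R⟦X⟧) hk i

/-- The tails of an infinite product are congruent to one modulo high powers of the variable. -/
theorem X_pow_dvd_tprod_sub_prod_range [IsTopologicalRing R] [T2Space R] (c : R⟦X⟧) {k : ℕ}
    (hk : 0 < k) (i : ℕ) {d N : ℕ} (hN : d ≤ N) :
    X ^ d ∣ ∏' m : ℕ, (1 + c * (X : R⟦X⟧) ^ (i + k * m)) -
      ∏ m ∈ Finset.range N, (1 + c * (X : R⟦X⟧) ^ (i + k * m)) := by
  have h1 : Multipliable fun m : ℕ => 1 + c * (X : R⟦X⟧) ^ (i + k * (m + N)) := by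
    simpa [mul_add, add_assoc, add_comm, add_left_comm] using
      multipliable_one_add_mul_X_pow c hk (i + k * N)
  have h2 := Multipliable.prod_mul_tprod_nat_mul' (f := fun m : ℕ => 1 + c * (X : R⟦X⟧) ^ (i + k * m)) h1
  rw [← h2, ← mul_sub_one]
  refine Dvd.dvd.mul_left (h1.hasProd.X_pow_dvd_sub_one fun m => ?_) _
  rw [add_sub_cancel_left]
  refine (pow_dvd_pow X ?_).mul_left _
  have : m + N ≤ k * (m + N) := Nat.le_mul_of_pos_left _ hk
  omega

end Topology

/-! ### Triangular numbers of integers -/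

section Triangle

/-- The triangular number `n (n + 1) / 2` of an integer. -/
def triangle (n : ℤ) : ℕ := (n * (n + 1) / 2).toNat

theorem two_mul_triangle (n : ℤ) : 2 * (triangle n : ℤ) = n * (n + 1) := by
  have h1 : 0 ≤ n * (n + 1) := by
    rcases le_or_gt 0 n with h | h
    · positivity
    · nlinarith
  rw [triangle, Int.toNat_of_nonneg (by omega), Int.mul_ediv_cancel' (Int.even_mul_succ_self n).two_dvd]

theorem triangle_eq (n : ℤ) : (triangle n : ℤ) = triangle (n - 1) + n := by
  have h1 := two_mul_triangle n
  have h2 := two_mul_triangle (n - 1)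
  nlinarith

theorem le_triangle (n : ℤ) : n ≤ triangle n := by
  have h1 := triangle_eq n
  omega

theorem neg_le_triangle_add_one (n : ℤ) : -n ≤ triangle n + 1 := by
  have h1 := triangle_eq (n + 1)
  rw [add_sub_cancel_right] at h1
  omega

@[simp] theorem triangle_zero : triangle 0 = 0 := rfl

@[simp] theorem triangle_neg_one : triangle (-1) = 0 := rfl

end Triangle

/-! ### Jacobi's triple product identity -/

section TripleProduct

variable {R : Type*} [CommRing R]

/-- The general term `u ^ n q ^ (i n (n + 1) / 2 + j n (n - 1) / 2)` of a theta series. -/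
noncomputable def thetaTerm (u : Rˣ) (i j : ℕ) (n : ℤ) : R⟦X⟧ :=
  C ((u ^ n : Rˣ) : R) * X ^ (i * triangle n + j * triangle (n - 1))

theorem finite_theta_exponent_lt {i j : ℕ} (h : 0 < i + j) (d : ℕ) :
    {n : ℤ | i * triangle n + j * triangle (n - 1) < d}.Finite := by
  refine (Set.finite_Icc (-(d : ℤ) - 2) (d + 2)).subset fun n hn => ?_
  have a1 := le_triangle n
  have a2 := le_triangle (n - 1)
  have a3 := neg_le_triangle_add_one n
  have a4 := neg_le_triangle_add_one (n - 1)
  simp only [Set.mem_ofPred_eq] at hn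
  have : triangle n < d ∨ triangle (n - 1) < d := by
    rcases Nat.eq_zero_or_pos i with hi | hi
    · right
      have : triangle (n - 1) ≤ j * triangle (n - 1) := Nat.le_mul_of_pos_left _ (by omega)
      omega
    · left
      have : triangle n ≤ i * triangle n := Nat.le_mul_of_pos_left _ hi
      omega
  simp only [Set.mem_Icc]
  omega

theorem orderTendsto_thetaTerm (u : Rˣ) {i j : ℕ} (h : 0 < i + j) :
    OrderTendsto (thetaTerm u i j) :=
  OrderTendsto.of_finite (finite_theta_exponent_lt h) _

/-- Exponent bookkeeping for the q-Pascal rule: the linear factor in u of the next finite product,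
applied to a neighbouring index, becomes a pure power of q at index n. `thetaTerm_add_one` is the
mirror image for u⁻¹. -/
theorem thetaTerm_sub_one (u : Rˣ) (i j N α : ℕ) (n : ℤ) (h : (α : ℤ) = N - n + 1) :
    C (u : R) * X ^ (i + (i + j) * N) * thetaTerm u i j (n - 1) =
      X ^ ((i + j) * α) * thetaTerm u i j n := by
  have h1 := triangle_eq n
  have h2 := triangle_eq (n - 1)
  have h3 : i + (i + j) * N + (i * triangle (n - 1) + j * triangle (n - 1 - 1)) =
      (i + j) * α + (i * triangle n + j * triangle (n - 1)) := by
    zify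
    rw [h, h1, h2]
    ring
  have h4 : (u : R) * ((u ^ (n - 1) : Rˣ) : R) = ((u ^ n : Rˣ) : R) := by
    rw [← Units.val_mul, ← zpow_one_add]; congr 2; ring
  calc _ = C ((u : R) * ((u ^ (n - 1) : Rˣ) : R)) *
        X ^ (i + (i + j) * N + (i * triangle (n - 1) + j * triangle (n - 1 - 1))) := by
        rw [thetaTerm, map_mul, pow_add]; ring
    _ = _ := by rw [h3, h4, thetaTerm, pow_add]; ring

theorem thetaTerm_add_one (u : Rˣ) (i j N β : ℕ) (n : ℤ) (h : (β : ℤ) = N + n + 1) :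
    C ((u⁻¹ : Rˣ) : R) * X ^ (j + (i + j) * N) * thetaTerm u i j (n + 1) =
      X ^ ((i + j) * β) * thetaTerm u i j n := by
  have h1 := triangle_eq (n + 1)
  have h2 := triangle_eq n
  have h3 : j + (i + j) * N + (i * triangle (n + 1) + j * triangle (n + 1 - 1)) =
      (i + j) * β + (i * triangle n + j * triangle (n - 1)) := by
    zify
    rw [h, h1]
    rw [add_sub_cancel_right, h2]
    ring
  have h4 : ((u⁻¹ : Rˣ) : R) * ((u ^ (n + 1) : Rˣ) : R) = ((u ^ n : Rˣ) : R) := by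
    rw [← Units.val_mul, ← zpow_neg_one, ← zpow_add]; congr 2; ring
  calc _ = C (((u⁻¹ : Rˣ) : R) * ((u ^ (n + 1) : Rˣ) : R)) *
        X ^ (j + (i + j) * N + (i * triangle (n + 1) + j * triangle (n + 1 - 1))) := by
        rw [thetaTerm, map_mul, pow_add]; ring
    _ = _ := by rw [h3, h4, thetaTerm, pow_add]; ring

variable [TopologicalSpace R]

variable (R) in
/-- The shifted tail `∏_{m ≥ n} (1 - q ^ (k m))` of an Euler product, set to zero for `n = 0`. -/
noncomputable def eulerTail (k : ℕ) : ℕ → R⟦X⟧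
  | 0 => 0
  | n + 1 => ∏' m : ℕ, (1 - X ^ (k * (n + 1) + k * m))

variable [T2Space R]

theorem X_pow_dvd_eulerTail_sub_one {k : ℕ} (hk : 0 < k) {d n : ℕ} (h : d ≤ n) :
    X ^ d ∣ eulerTail R k (n + 1) - 1 := by
  refine (multipliable_one_sub_X_pow_add hk _).hasProd.X_pow_dvd_sub_one fun m => ?_
  rw [sub_sub_cancel_left, dvd_neg]
  refine pow_dvd_pow X ?_
  have : n + 1 ≤ k * (n + 1) := Nat.le_mul_of_pos_left _ hk
  omega

theorem isUnit_eulerTail_one {k : ℕ} (hk : 0 < k) : IsUnit (eulerTail R k 1) := by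
  rw [PowerSeries.isUnit_iff_constantCoeff]
  have h := (multipliable_one_sub_X_pow_add (R := R) hk (k * (0 + 1))).hasProd.X_pow_dvd_sub_one
    (d := 1) fun m => by
      rw [sub_sub_cancel_left, dvd_neg]
      exact pow_dvd_pow X (by omega)
  have := X_pow_dvd_iff.mp h 0 one_pos
  rw [map_sub, sub_eq_zero] at this
  have h2 : constantCoeff (eulerTail R k 1) = 1 := by
    rw [← coeff_zero_eq_constantCoeff_apply]
    refine this.trans ?_
    simp
  rw [h2]
  exact isUnit_one

variable [IsTopologicalRing R]

theorem eulerTail_eq {k : ℕ} (hk : 0 < k) (n : ℕ) :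
    eulerTail R k n = (1 - X ^ (k * n)) * eulerTail R k (n + 1) := by
  cases n with
  | zero => simp [eulerTail]
  | succ n =>
    have h : Multipliable fun m : ℕ => 1 - (X : R⟦X⟧) ^ (k * (n + 1) + k * (m + 1)) := by
      simpa [mul_add, add_assoc, add_comm, add_left_comm] using
        multipliable_one_sub_X_pow_add (R := R) hk (k * (n + 1) + k)
    have h2 := tprod_eq_zero_mul' (f := fun m : ℕ => 1 - (X : R⟦X⟧) ^ (k * (n + 1) + k * m)) h
    have h3 : ∀ m, k * (n + 1) + k * (m + 1) = k * (n + 1 + 1) + k * m := fun m => by ring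
    simp only [h3, mul_zero, add_zero] at h2
    exact h2

/-- The terms of the finite form of the triple product identity. -/
noncomputable def finiteThetaTerm (u : Rˣ) (i j N : ℕ) (n : ℤ) : R⟦X⟧ :=
  thetaTerm u i j n * (∏ l ∈ Finset.range (2 * N), (1 - X ^ ((i + j) * (l + 1)))) *
    (eulerTail R (i + j) (N - n + 1).toNat * eulerTail R (i + j) (N + n + 1).toNat)

/-- With Q = q^(i+j), the term is E² times the Q-binomial coefficient [2N, N+n] times the theta
term, since E/(Q;Q)_m is the tail from m+1. The recurrence is the two-sided Q-Pascal rule, matching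
the expansion of (1 + u q^(i+kN))(1 + u⁻¹ q^(j+kN)), k = i+j. -/
theorem finiteThetaTerm_succ (u : Rˣ) {i j : ℕ} (hk : 0 < i + j) (N : ℕ) (n : ℤ) :
    finiteThetaTerm u i j (N + 1) n =
      (1 + X ^ ((i + j) * (2 * N + 1))) * finiteThetaTerm u i j N n +
      C (u : R) * X ^ (i + (i + j) * N) * finiteThetaTerm u i j N (n - 1) +
      C ((u⁻¹ : Rˣ) : R) * X ^ (j + (i + j) * N) * finiteThetaTerm u i j N (n + 1) := by
  have e1 : (((N + 1 : ℕ) : ℤ) - n + 1).toNat = (N - n + 1 + 1).toNat := by congr 1; push_cast; ring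
  have e2 : (((N + 1 : ℕ) : ℤ) + n + 1).toNat = (N + n + 1 + 1).toNat := by congr 1; push_cast; ring
  have e3 : ((N : ℤ) - (n - 1) + 1).toNat = (N - n + 1 + 1).toNat := by congr 1; ring
  have e4 : ((N : ℤ) + (n - 1) + 1).toNat = (N + n + 1 - 1).toNat := by congr 1; ring
  have e5 : ((N : ℤ) - (n + 1) + 1).toNat = (N - n + 1 - 1).toNat := by congr 1; ring
  have e6 : ((N : ℤ) + (n + 1) + 1).toNat = (N + n + 1 + 1).toNat := by congr 1; ring
  simp only [finiteThetaTerm, e1, e2, e3, e4, e5, e6]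
  -- Outside the range of the binomial coefficients `toNat` gives index 0, where `eulerTail` is 0;
  -- this plays the role of 1/(Q;Q)_m = 0 for m < 0.
  rcases lt_or_ge ((N : ℤ) - n + 1) 0 with hA | hA
  · have a1 : ((N : ℤ) - n + 1 + 1).toNat = 0 := by omega
    have a2 : ((N : ℤ) - n + 1).toNat = 0 := by omega
    have a3 : ((N : ℤ) - n + 1 - 1).toNat = 0 := by omega
    rw [a1, a2, a3, eulerTail]
    ring
  rcases lt_or_ge ((N : ℤ) + n + 1) 0 with hB | hB
  · have a1 : ((N : ℤ) + n + 1 + 1).toNat = 0 := by omega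
    have a2 : ((N : ℤ) + n + 1).toNat = 0 := by omega
    have a3 : ((N : ℤ) + n + 1 - 1).toNat = 0 := by omega
    rw [a1, a2, a3, eulerTail]
    ring
  obtain ⟨α, hα⟩ := Int.eq_ofNat_of_zero_le hA
  obtain ⟨β, hβ⟩ := Int.eq_ofNat_of_zero_le hB
  have hαβ : α + β = 2 * N + 2 := by omega
  have t1 := thetaTerm_sub_one u i j N α n hα.symm
  have t2 := thetaTerm_add_one u i j N β n hβ.symm
  rw [hα, hβ]
  have b1 : ((α : ℤ) + 1).toNat = α + 1 := by omega
  have b2 : ((β : ℤ) + 1).toNat = β + 1 := by omega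
  have b3 : ((α : ℤ) - 1).toNat = α - 1 := by omega
  have b4 : ((β : ℤ) - 1).toNat = β - 1 := by omega
  rw [b1, b2, b3, b4, Int.toNat_natCast, Int.toNat_natCast]
  set k := i + j with hkdef
  have r1 := eulerTail_eq (R := R) hk α
  have r2 := eulerTail_eq (R := R) hk β
  have r3 : X ^ (k * β) * eulerTail R k (α - 1) =
      (X ^ (k * β) - X ^ (k * (2 * N + 1))) * eulerTail R k α := by
    rcases Nat.eq_zero_or_pos α with h | h
    · subst h; simp [eulerTail]
    · have := eulerTail_eq (R := R) hk (α - 1)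
      rw [Nat.sub_add_cancel h] at this
      rw [this, ← mul_assoc, mul_sub, mul_one, ← pow_add, ← mul_add]
      congr 4; omega
  have r4 : X ^ (k * α) * eulerTail R k (β - 1) =
      (X ^ (k * α) - X ^ (k * (2 * N + 1))) * eulerTail R k β := by
    rcases Nat.eq_zero_or_pos β with h | h
    · subst h; simp [eulerTail]
    · have := eulerTail_eq (R := R) hk (β - 1)
      rw [Nat.sub_add_cancel h] at this
      rw [this, ← mul_assoc, mul_sub, mul_one, ← pow_add, ← mul_add]
      congr 4; omega
  have r5 : (X : R⟦X⟧) ^ (k * (2 * N + 1 + 1)) = X ^ (k * α) * X ^ (k * β) := by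
    rw [← pow_add, ← mul_add, hαβ]
  have r6 : ∏ l ∈ Finset.range (2 * (N + 1)), (1 - (X : R⟦X⟧) ^ (k * (l + 1))) =
      (∏ l ∈ Finset.range (2 * N), (1 - (X : R⟦X⟧) ^ (k * (l + 1)))) *
        ((1 - X ^ (k * (2 * N + 1))) * (1 - X ^ (k * α) * X ^ (k * β))) := by
    rw [show 2 * (N + 1) = 2 * N + 1 + 1 by ring, Finset.prod_range_succ, Finset.prod_range_succ, r5,
      mul_assoc]
  rw [r6]
  generalize ∏ l ∈ Finset.range (2 * N), (1 - (X : R⟦X⟧) ^ (k * (l + 1))) = p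
  generalize eulerTail R k (α + 1) = sA at *
  generalize eulerTail R k (β + 1) = sB at *
  generalize eulerTail R k (α - 1) = sA0 at *
  generalize eulerTail R k (β - 1) = sB0 at *
  rw [r1] at r3 ⊢
  rw [r2] at r4 ⊢
  generalize (X : R⟦X⟧) ^ (k * α) = A at *
  generalize (X : R⟦X⟧) ^ (k * β) = B at *
  generalize (X : R⟦X⟧) ^ (k * (2 * N + 1)) = Z at *
  generalize thetaTerm u i j n = w at *
  linear_combination (-p * sA * sB0) * t1 - p * sA0 * sB * t2 - w * p * sA * r4 - w * p * sB * r3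

/-- The finite triple product, by induction on N. The factor E² stands in for dividing by the finite
Euler products, so that everything stays polynomial in the tails. -/
theorem hasSum_finiteThetaTerm (u : Rˣ) {i j : ℕ} (hk : 0 < i + j) (N : ℕ) :
    HasSum (finiteThetaTerm u i j N) (eulerTail R (i + j) 1 ^ 2 *
      ((∏ m ∈ Finset.range N, (1 + C (u : R) * X ^ (i + (i + j) * m))) *
        ∏ m ∈ Finset.range N, (1 + C ((u⁻¹ : Rˣ) : R) * X ^ (j + (i + j) * m)))) := by
  induction N with
  | zero =>
    have h : ∀ n : ℤ, n ≠ 0 → finiteThetaTerm u i j 0 n = 0 := by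
      intro n hn
      have : (((0 : ℕ) : ℤ) - n + 1).toNat = 0 ∨ (((0 : ℕ) : ℤ) + n + 1).toNat = 0 := by omega
      rcases this with h | h <;> simp only [finiteThetaTerm, h, eulerTail] <;> ring
    convert hasSum_single (0 : ℤ) h using 1
    simp [finiteThetaTerm, thetaTerm, sq]
  | succ N ih =>
    have h1 := ih.mul_left (1 + X ^ ((i + j) * (2 * N + 1)))
    have h2 := (((Equiv.subRight (1 : ℤ)).hasSum_iff).mpr ih).mul_left
      (C (u : R) * X ^ (i + (i + j) * N))
    have h3 := (((Equiv.addRight (1 : ℤ)).hasSum_iff).mpr ih).mul_left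
      (C ((u⁻¹ : Rˣ) : R) * X ^ (j + (i + j) * N))
    rw [show finiteThetaTerm u i j (N + 1) = _ from funext fun n => finiteThetaTerm_succ u hk N n]
    refine Eq.mp (congrArg (fun x => HasSum _ x) ?_) ((h1.add h2).add h3)
    · rw [Finset.prod_range_succ, Finset.prod_range_succ]
      have e1 : C (u : R) * C ((u⁻¹ : Rˣ) : R) = 1 := by rw [← map_mul]; simp
      have e2 : (X : R⟦X⟧) ^ ((i + j) * (2 * N + 1)) =
          X ^ (i + (i + j) * N) * X ^ (j + (i + j) * N) := by rw [← pow_add]; congr 1; ring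
      rw [e2]
      linear_combination -(eulerTail R (i + j) 1 ^ 2 *
        ((∏ m ∈ Finset.range N, (1 + C (u : R) * X ^ (i + (i + j) * m))) *
        ∏ m ∈ Finset.range N, (1 + C ((u⁻¹ : Rˣ) : R) * X ^ (j + (i + j) * m))) *
        X ^ (i + (i + j) * N) * X ^ (j + (i + j) * N)) * e1

/-- Jacobi's triple product identity. -/
theorem hasSum_thetaTerm (u : Rˣ) {i j : ℕ} (hk : 0 < i + j) :
    HasSum (thetaTerm u i j) ((∏' m : ℕ, (1 - X ^ ((i + j) + (i + j) * m))) *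
      ((∏' m : ℕ, (1 + C (u : R) * X ^ (i + (i + j) * m))) *
        ∏' m : ℕ, (1 + C ((u⁻¹ : Rˣ) : R) * X ^ (j + (i + j) * m)))) := by
  set k := i + j with hkdef
  have hE : eulerTail R k 1 = ∏' m : ℕ, (1 - X ^ (k + k * m)) := by simp [eulerTail]
  rw [← hE]
  have hsum := (orderTendsto_thetaTerm u hk).summable.hasSum
  set S := ∑' n, thetaTerm u i j n
  set E := eulerTail R k 1
  set A := ∏' m : ℕ, (1 + C (u : R) * X ^ (i + k * m))
  set B := ∏' m : ℕ, (1 + C ((u⁻¹ : Rˣ) : R) * X ^ (j + k * m))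
  -- E is a unit; the extra factor makes the right side the limit of the finite identities, which
  -- carry E².
  suffices E * S = E * (E * (A * B)) by
    rw [(isUnit_eulerTail_one hk).mul_left_cancel this] at hsum
    exact hsum
  refine eq_of_forall_X_pow_dvd_sub fun d => ?_
  obtain ⟨K, hK⟩ : ∃ K : ℕ, ∀ n : ℤ, ¬ (X ^ d ∣ thetaTerm u i j n) → |n| ≤ K := by
    obtain ⟨s, hs⟩ := ((orderTendsto_thetaTerm u hk) d).exists_finset_coe
    refine ⟨s.sup fun n => n.natAbs, fun n hn => ?_⟩
    have : n ∈ s := by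
      rw [← Finset.mem_coe, hs]; exact hn
    have := Finset.le_sup (f := fun n : ℤ => n.natAbs) this
    rw [Int.abs_eq_natAbs]
    exact_mod_cast this
  -- For |n| ≤ K both tails then begin beyond d, so they are 1 modulo X^d; all other theta terms
  -- vanish modulo X^d.
  set N := d + K
  have hA := X_pow_dvd_tprod_sub_prod_range (C (u : R)) hk i (d := d) (N := N) (by omega)
  have hB := X_pow_dvd_tprod_sub_prod_range (C ((u⁻¹ : Rˣ) : R)) hk j (d := d) (N := N) (by omega)
  have hfin := hasSum_finiteThetaTerm u hk N
  rw [← hkdef] at hfin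
  have hEN : X ^ d ∣ E - ∏ l ∈ Finset.range (2 * N), (1 - X ^ (k * (l + 1))) := by
    have := X_pow_dvd_tprod_sub_prod_range (-1 : R⟦X⟧) hk k (d := d) (N := 2 * N) (by omega)
    have e : ∀ m, 1 + -1 * (X : R⟦X⟧) ^ (k + k * m) = 1 - X ^ (k * (m + 1)) := by
      intro m; rw [mul_add_one, add_comm k]; ring
    have e' : ∀ m, 1 - (X : R⟦X⟧) ^ (k + k * m) = 1 - X ^ (k * (m + 1)) := by
      intro m; rw [mul_add_one, add_comm k]
    rw [hE]
    simp only [e] at this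
    simpa only [e'] using this
  have hdiff := ((hsum.mul_left E).sub hfin).X_pow_dvd (d := d) fun n => by
    by_cases hn : X ^ d ∣ thetaTerm u i j n
    · rw [finiteThetaTerm, mul_assoc, mul_comm E, ← mul_sub]
      exact hn.mul_right _
    · have := hK n hn
      rw [abs_le] at this
      obtain ⟨α, hα⟩ := Int.eq_ofNat_of_zero_le (show 0 ≤ (N : ℤ) - n by omega)
      obtain ⟨β, hβ⟩ := Int.eq_ofNat_of_zero_le (show 0 ≤ (N : ℤ) + n by omega)
      have hs := X_pow_dvd_sub_one_mul
        (X_pow_dvd_eulerTail_sub_one (R := R) hk (show d ≤ α by omega))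
        (X_pow_dvd_eulerTail_sub_one (R := R) hk (show d ≤ β by omega))
      rw [finiteThetaTerm, hα, hβ, show ((α : ℤ) + 1).toNat = α + 1 by omega,
        show ((β : ℤ) + 1).toNat = β + 1 by omega, ← hkdef]
      have : ∀ w p s : R⟦X⟧, E * w - w * p * s = w * ((E - p) - p * (s - 1)) := by
        intros; ring
      rw [this]
      exact (dvd_sub hEN (hs.mul_left _)).mul_left _
  have : ∀ a b : R⟦X⟧, E * S - E * (E * (A * B)) =
      (E * S - E ^ 2 * (a * b)) - E ^ 2 * ((A - a) * B + a * (B - b)) := by intros; ring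
  rw [this]
  exact dvd_sub hdiff ((dvd_add (hA.mul_right _) (hB.mul_left _)).mul_left _)

end TripleProduct

/-! ### Products over arithmetic progressions -/

section ProgressionProduct

variable {R : Type*} [CommRing R] [TopologicalSpace R]

/-- The product `∏_{m ≥ 0} (1 + c q ^ (i + k m))`. -/
noncomputable def progProd (c : R) (i k : ℕ) : R⟦X⟧ := ∏' m : ℕ, (1 + C c * X ^ (i + k * m))

theorem hasProd_progProd (c : R) (i : ℕ) {k : ℕ} (hk : 0 < k) :
    HasProd (fun m : ℕ => 1 + C c * X ^ (i + k * m)) (progProd c i k) :=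
  (multipliable_one_add_mul_X_pow (C c) hk i).hasProd

variable [IsTopologicalRing R] [T2Space R]

theorem progProd_eq_prod_residues (c : R) (i : ℕ) {k n : ℕ} (hk : 0 < k) (hn : 0 < n) :
    progProd c i k = ∏ r : Fin n, progProd c (i + k * r) (n * k) := by
  have : NeZero n := ⟨hn.ne'⟩
  have h := hasProd_progProd c i hk
  rw [← (Nat.divModEquiv n).symm.hasProd_iff, ← (Equiv.prodComm _ _).hasProd_iff] at h
  have h2 := h.prod_fiberwise (g := fun r : Fin n => progProd c (i + k * r) (n * k)) fun r => by
    convert hasProd_progProd c (i + k * r) (Nat.mul_pos hn hk) using 4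
    simp [Nat.divModEquiv]
    ring
  exact h2.unique (hasProd_fintype _)

theorem progProd_two (c : R) (i : ℕ) {k : ℕ} (hk : 0 < k) :
    progProd c i k = progProd c i (2 * k) * progProd c (i + k) (2 * k) := by
  simpa [Fin.prod_univ_two] using progProd_eq_prod_residues c i hk two_pos

theorem progProd_three (c : R) (i : ℕ) {k : ℕ} (hk : 0 < k) :
    progProd c i k =
      progProd c i (3 * k) * progProd c (i + k) (3 * k) * progProd c (i + k * 2) (3 * k) := by
  simpa [Fin.prod_univ_three] using progProd_eq_prod_residues c i hk three_pos

theorem progProd_neg_one_mul_one (i : ℕ) {k : ℕ} (hk : 0 < k) :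
    progProd (-1 : R) i k * progProd 1 i k = progProd (-1) (2 * i) (2 * k) := by
  refine ((hasProd_progProd _ i hk).mul (hasProd_progProd _ i hk)).unique ?_
  convert hasProd_progProd (-1 : R) (2 * i) (Nat.mul_pos two_pos hk) using 2 with m
  have : 2 * i + 2 * k * m = (i + k * m) * 2 := by ring
  rw [this, pow_mul]
  simp
  ring

theorem progProd_succ (c : R) (i : ℕ) {k : ℕ} (hk : 0 < k) :
    progProd c i k = (1 + C c * X ^ i) * progProd c (i + k) k := by
  have h : Multipliable fun m : ℕ => 1 + C c * (X : R⟦X⟧) ^ (i + k * (m + 1)) := by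
    simpa [mul_add, add_assoc, add_comm, add_left_comm] using
      multipliable_one_add_mul_X_pow (C c) hk (i + k)
  have h2 := tprod_eq_zero_mul' (f := fun m : ℕ => 1 + C c * (X : R⟦X⟧) ^ (i + k * m)) h
  have h3 : ∀ m, i + k * (m + 1) = i + k + k * m := fun m => by ring
  simp only [h3, mul_zero, add_zero] at h2
  exact h2

theorem progProd_zero_eq (c : R) {k : ℕ} (hk : 0 < k) :
    progProd c 0 k = (1 + C c) * progProd c k k := by
  simpa using progProd_succ c 0 hk

omit [IsTopologicalRing R] in
theorem constantCoeff_progProd (c : R) {i k : ℕ} (hi : 0 < i) (hk : 0 < k) :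
    constantCoeff (progProd c i k) = 1 := by
  have h := (hasProd_progProd c i hk).X_pow_dvd_sub_one (d := 1) fun m => by
    rw [add_sub_cancel_left]
    exact (pow_dvd_pow X (by omega)).mul_left _
  have := X_pow_dvd_iff.mp h 0 one_pos
  rw [map_sub, sub_eq_zero] at this
  rw [← coeff_zero_eq_constantCoeff_apply]
  refine this.trans (by simp)

/-- Jacobi's triple product identity in terms of `progProd`. -/
theorem hasSum_thetaTerm_progProd (u : Rˣ) (i j : ℕ) {k : ℕ} (hij : i + j = k) (hk : 0 < k) :
    HasSum (thetaTerm u i j)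
      (progProd (-1) k k * (progProd (u : R) i k * progProd ((u⁻¹ : Rˣ) : R) j k)) := by
  subst hij
  convert hasSum_thetaTerm u hk using 2
  · simp [progProd, sub_eq_add_neg]
  · rfl

end ProgressionProduct

/-! ### Compatibility with q ↦ q^n, q ↦ aq and change of coefficients -/

section Maps

variable {R : Type*} [CommRing R] [TopologicalSpace R]

theorem continuous_of_continuous_coeff {R S : Type*} [CommRing R] [TopologicalSpace R]
    [CommRing S] [TopologicalSpace S] {φ : R⟦X⟧ → S⟦X⟧}
    (h : ∀ n, Continuous fun f => coeff n (φ f)) : Continuous φ := by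
  refine continuous_iff_continuousAt.mpr fun f => ?_
  refine (WithPiTopology.tendsto_iff_coeff_tendsto S _ _ _).mpr fun n => (h n).continuousAt

theorem continuous_expand {n : ℕ} (hn : n ≠ 0) : Continuous (expand n hn : R⟦X⟧ →ₐ[R] R⟦X⟧) := by
  refine continuous_of_continuous_coeff fun m => ?_
  simp only [coeff_expand]
  split_ifs
  · exact WithPiTopology.continuous_coeff R _
  · exact continuous_const

theorem continuous_rescale [IsTopologicalRing R] (a : R) : Continuous (rescale a : R⟦X⟧ →+* R⟦X⟧) := by
  refine continuous_of_continuous_coeff fun m => ?_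
  simp only [coeff_rescale]
  exact (WithPiTopology.continuous_coeff R _).const_mul _

theorem continuous_map {S : Type*} [CommRing S] [TopologicalSpace S] {φ : R →+* S}
    (hφ : Continuous φ) : Continuous (PowerSeries.map φ) := by
  refine continuous_of_continuous_coeff fun m => ?_
  simp only [coeff_map]
  exact hφ.comp (WithPiTopology.continuous_coeff R _)

theorem expand_progProd [T2Space R] (c : R) (i : ℕ) {k n : ℕ} (hk : 0 < k) (hn : n ≠ 0) :
    expand n hn (progProd c i k) = progProd c (n * i) (n * k) := by
  have h := (hasProd_progProd c i hk).map (expand n hn : R⟦X⟧ →ₐ[R] R⟦X⟧) (continuous_expand hn)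
  refine h.unique ?_
  convert hasProd_progProd c (n * i) (Nat.mul_pos (Nat.pos_of_ne_zero hn) hk) using 2 with m
  simp only [Function.comp, map_add, map_mul, map_one, map_pow, expand_C, expand_X, ← pow_mul]
  congr 3; ring

theorem rescale_progProd [T2Space R] [IsTopologicalRing R] (a c : R) (i : ℕ) {k : ℕ} (hk : 0 < k)
    (ha : a ^ k = 1) : rescale a (progProd c i k) = progProd (c * a ^ i) i k := by
  have h := (hasProd_progProd c i hk).map (rescale a : R⟦X⟧ →+* R⟦X⟧) (continuous_rescale a)
  refine h.unique ?_
  convert hasProd_progProd (c * a ^ i) i hk using 2 with m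
  have : rescale a (C c) = C c := by
    ext n
    rw [coeff_rescale, coeff_C]
    split_ifs with h <;> simp [h]
  simp only [Function.comp, map_add, map_mul, map_one, map_pow, this, rescale_X, mul_pow]
  rw [pow_add (C a) i, pow_mul (C a) k, ← map_pow C a k, ha]
  simp [mul_assoc]

theorem map_progProd {S : Type*} [CommRing S] [TopologicalSpace S] [T2Space S] {φ : R →+* S}
    (hφ : Continuous φ) (c : R) (i : ℕ) {k : ℕ} (hk : 0 < k) :
    PowerSeries.map φ (progProd c i k) = progProd (φ c) i k := by
  have h := (hasProd_progProd c i hk).map (PowerSeries.map φ) (continuous_map hφ)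
  refine h.unique ?_
  convert hasProd_progProd (φ c) i hk using 2 with m
  simp

end Maps

theorem eulerSeries_eq_progProd (k : ℕ+) : eulerSeries k = progProd (-1) (k : ℕ) k := by
  simp only [eulerSeries, progProd]
  congr 1
  ext1 m
  rw [mul_add_one, add_comm (k * m : ℕ)]
  simp [sub_eq_add_neg]

/-- The tool for all dissections: a lattice sum is split over cosets, each parametrized by its own
map. -/
theorem HasSum.of_bijective_sumElim {M ι κ₁ κ₂ : Type*} [AddCommMonoid M] [TopologicalSpace M]
    [ContinuousAdd M] {f : ι → M} {g₁ : κ₁ → ι} {g₂ : κ₂ → ι} {a b : M}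
    (hg : Function.Bijective (Sum.elim g₁ g₂)) (h₁ : HasSum (f ∘ g₁) a) (h₂ : HasSum (f ∘ g₂) b) :
    HasSum f (a + b) := by
  have h1 : Function.Injective g₁ := fun x y h => Sum.inl_injective (hg.1 (by simpa using h))
  have h2 : Function.Injective g₂ := fun x y h => Sum.inr_injective (hg.1 (by simpa using h))
  refine (h1.hasSum_range_iff.2 h₁).add_isCompl ?_ (h2.hasSum_range_iff.2 h₂)
  refine isCompl_iff.mpr ⟨?_, ?_⟩
  · rw [Set.disjoint_left]
    rintro _ ⟨x, rfl⟩ ⟨y, hy⟩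
    exact Sum.inl_ne_inr (hg.1 (a₁ := .inl x) (a₂ := .inr y) (by simpa using hy.symm))
  · rw [codisjoint_iff_le_sup]
    rintro x -
    obtain ⟨y | y, rfl⟩ := hg.2 x <;> simp

/-! ### Theta series as Euler quotients -/

section Theta

/-- The theta series `∑ u ^ n q ^ (i n (n + 1) / 2 + j n (n - 1) / 2)` with integer coefficients. -/
noncomputable def theta (u : ℤˣ) (i j : ℕ) : ℤ⟦X⟧ := ∑' n, thetaTerm u i j n

theorem hasSum_theta (u : ℤˣ) {i j : ℕ} (h : 0 < i + j) :
    HasSum (thetaTerm u i j) (theta u i j) := (orderTendsto_thetaTerm u h).summable.hasSum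

theorem theta_eq (u : ℤˣ) (i j k : ℕ) (hij : i + j = k) (hk : 0 < k) :
    theta u i j = progProd (-1) k k * (progProd (u : ℤ) i k * progProd ((u⁻¹ : ℤˣ) : ℤ) j k) :=
  (hasSum_theta u (hij.symm ▸ hk)).unique (hasSum_thetaTerm_progProd u i j hij hk)

theorem expand_theta (u : ℤˣ) {i j n : ℕ} (h : 0 < i + j) (hn : n ≠ 0) :
    expand n hn (theta u i j) = theta u (n * i) (n * j) := by
  rw [theta_eq u i j _ rfl h, theta_eq u (n * i) (n * j) (n * (i + j)) (by ring)
    (Nat.mul_pos (Nat.pos_of_ne_zero hn) h)]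
  simp only [map_mul]
  rw [expand_progProd _ _ h, expand_progProd _ _ h, expand_progProd _ _ h]

/-- The Euler product `∏_{m ≥ 1} (1 - q ^ (k m))`, for a natural number `k`. -/
noncomputable def eulerProd (k : ℕ) : ℤ⟦X⟧ := progProd (-1) k k

theorem expand_eulerProd {k n : ℕ} (hk : 0 < k) (hn : n ≠ 0) :
    expand n hn (eulerProd k) = eulerProd (n * k) := expand_progProd _ _ hk hn

theorem eulerProd_ne_zero {k : ℕ} (hk : 0 < k) : eulerProd k ≠ 0 := by
  intro h
  have := constantCoeff_progProd (-1 : ℤ) hk hk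
  rw [← eulerProd, h] at this
  simp at this

local notation "F" => eulerProd

theorem eulerProd_one_eq : F 1 = progProd (-1) 1 2 * F 2 := progProd_two (-1) 1 one_pos

theorem progProd_neg_one_two_four : F 2 = progProd (-1) 2 4 * F 4 := progProd_two (-1) 2 two_pos

theorem eulerProd_mul_progProd_one_two : F 1 * F 4 * progProd 1 1 2 = F 2 ^ 2 := by
  have h := progProd_neg_one_mul_one (R := ℤ) 1 two_pos
  rw [eulerProd_one_eq]
  linear_combination F 2 * F 4 * h - F 2 * progProd_neg_one_two_four

theorem eulerProd_three_mul_progProd : F 3 * F 12 * progProd 1 3 6 = F 6 ^ 2 := by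
  have h := congrArg (expand 3 three_ne_zero) eulerProd_mul_progProd_one_two
  simp only [map_mul, map_pow] at h
  rw [expand_progProd _ _ two_pos, expand_eulerProd, expand_eulerProd, expand_eulerProd] at h <;>
    norm_num at *
  exact h

theorem eulerProd_one_mul_progProd_one : F 1 * progProd 1 1 1 = F 2 :=
  progProd_neg_one_mul_one 1 one_pos

theorem theta_neg_one_one_one : theta (-1) 1 1 * F 2 = F 1 ^ 2 := by
  rw [theta_eq (-1) 1 1 2 rfl two_pos, eulerProd_one_eq, eulerProd]
  simp only [inv_neg, inv_one, Units.val_neg, Units.val_one]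
  ring

theorem theta_one_one_one : theta 1 1 1 * (F 1 ^ 2 * F 4 ^ 2) = F 2 ^ 5 := by
  rw [theta_eq 1 1 1 2 rfl two_pos]
  simp only [inv_one, Units.val_one]
  have h := eulerProd_mul_progProd_one_two
  rw [← eulerProd]
  linear_combination F 2 * (F 1 * F 4 * progProd 1 1 2 + F 2 ^ 2) * h

theorem theta_one_one_zero : theta 1 1 0 * F 1 = 2 * F 2 ^ 2 := by
  rw [theta_eq 1 1 0 1 rfl one_pos, ← eulerProd]
  simp only [inv_one, Units.val_one]
  rw [progProd_zero_eq 1 one_pos, ← eulerProd_one_mul_progProd_one, map_one]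
  ring

/-- The progressions 1 and 2 mod 3 are all positive integers except the multiples of 3, so the
product is f_3 (f_2/f_1)/(f_6/f_3). The two quotients with 1 and 5 below arise likewise by removing
3 mod 6 from the odd numbers. -/
theorem theta_one_one_two : theta 1 1 2 * (F 1 * F 6) = F 2 * F 3 ^ 2 := by
  have h3 := progProd_three (1 : ℤ) 1 one_pos
  have h6 : F 3 * progProd 1 3 3 = F 6 := progProd_neg_one_mul_one 3 three_pos
  have h1 := eulerProd_one_mul_progProd_one
  norm_num at h3
  rw [theta_eq 1 1 2 3 rfl three_pos, ← eulerProd]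
  simp only [inv_one, Units.val_one]
  rw [h3] at h1
  linear_combination F 3 ^ 2 * h1 - F 3 * progProd 1 1 3 * progProd 1 2 3 * F 1 * h6

theorem theta_one_one_five : theta 1 1 5 * (F 1 * F 4 * F 6) = F 2 ^ 2 * F 3 * F 12 := by
  have h3 := progProd_three (1 : ℤ) 1 two_pos
  have h1 := eulerProd_mul_progProd_one_two
  have h6 := eulerProd_three_mul_progProd
  norm_num at h3
  rw [theta_eq 1 1 5 6 rfl (by norm_num), ← eulerProd]
  simp only [inv_one, Units.val_one]
  rw [h3] at h1
  linear_combination F 3 * F 12 * h1 - progProd 1 1 6 * progProd 1 5 6 * F 1 * F 4 * h6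

theorem theta_neg_one_one_five : theta (-1) 1 5 * (F 2 * F 3) = F 1 * F 6 ^ 2 := by
  have h3 := progProd_three (-1 : ℤ) 1 two_pos
  have h6 : F 3 = progProd (-1) 3 6 * F 6 := progProd_two (-1) 3 three_pos
  norm_num at h3
  rw [theta_eq (-1) 1 5 6 rfl (by norm_num), ← eulerProd, eulerProd_one_eq, h3, h6]
  simp only [inv_neg, inv_one, Units.val_neg, Units.val_one]
  ring

end Theta

/-! ### Dissections of theta series and of their products -/

section Dissections

theorem thetaTerm_one (i j : ℕ) (n : ℤ) :
    (thetaTerm 1 i j n : ℤ⟦X⟧) = X ^ (i * triangle n + j * triangle (n - 1)) := by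
  simp [thetaTerm]

theorem thetaTerm_neg_one (i j : ℕ) (n : ℤ) :
    (thetaTerm (-1) i j n : ℤ⟦X⟧) =
      C ((((-1 : ℤˣ) ^ n : ℤˣ) : ℤ)) * X ^ (i * triangle n + j * triangle (n - 1)) := rfl

theorem neg_one_zpow_eq {m n : ℤ} (h : (m - n) % 2 = 0) : (-1 : ℤˣ) ^ m = (-1) ^ n := by
  obtain ⟨k, hk⟩ := Int.dvd_of_emod_eq_zero h
  rw [show m = n + 2 * k by omega, zpow_add, zpow_mul]
  simp

theorem neg_one_zpow_eq_neg {m n : ℤ} (h : (m - n) % 2 = 1) : (-1 : ℤˣ) ^ m = -(-1) ^ n := by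
  rw [neg_one_zpow_eq (n := n + 1) (by omega), zpow_add]
  simp

theorem C_neg_one_zpow_mul (m n : ℤ) :
    (C (((-1 : ℤˣ) ^ m : ℤˣ) : ℤ) * C (((-1 : ℤˣ) ^ n : ℤˣ) : ℤ) : ℤ⟦X⟧) =
      C (((-1 : ℤˣ) ^ (m + n) : ℤˣ) : ℤ) := by
  rw [← map_mul, zpow_add, Units.val_mul]

theorem C_neg_one_zpow_of_even {m : ℤ} (h : m % 2 = 0) :
    (C (((-1 : ℤˣ) ^ m : ℤˣ) : ℤ) : ℤ⟦X⟧) = 1 := by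
  rw [neg_one_zpow_eq (n := 0) (by omega)]; simp

theorem C_neg_one_zpow_of_odd {m : ℤ} (h : m % 2 = 1) :
    (C (((-1 : ℤˣ) ^ m : ℤˣ) : ℤ) : ℤ⟦X⟧) = -1 := by
  rw [neg_one_zpow_eq_neg (n := 0) (by omega)]; simp

theorem HasSum.of_forall_eq {M ι : Type*} [AddCommMonoid M] [TopologicalSpace M] {f g : ι → M} {a : M}
    (hf : HasSum f a) (h : ∀ x, g x = f x) : HasSum g a := (funext h : g = f) ▸ hf

theorem theta_comm (u : ℤˣ) {i j : ℕ} (h : 0 < i + j) : theta u i j = theta u⁻¹ j i := by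
  rw [theta_eq u i j _ rfl h, theta_eq u⁻¹ j i (i + j) (add_comm _ _) h, inv_inv]
  ring

theorem hasSum_theta_mul (u v : ℤˣ) {i j k l : ℕ} (h : 0 < i + j) (h' : 0 < k + l) :
    HasSum (fun x : ℤ × ℤ => thetaTerm u i j x.1 * thetaTerm v k l x.2)
      (theta u i j * theta v k l) :=
  (hasSum_theta u h).mul_of_orderTendsto (hasSum_theta v h') (orderTendsto_thetaTerm u h)
    (orderTendsto_thetaTerm v h')

/-- Pairs of integers of equal parity. -/
def evenPair (p : ℤ × ℤ) : ℤ × ℤ := (p.1 + p.2, p.1 - p.2)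

/-- Pairs of integers of different parity. -/
def oddPair (p : ℤ × ℤ) : ℤ × ℤ := (p.1 + p.2 + 1, p.1 - p.2)

theorem bijective_parity : Function.Bijective (Sum.elim evenPair oddPair) := by
  constructor
  · rintro (⟨a, b⟩ | ⟨a, b⟩) (⟨c, d⟩ | ⟨c, d⟩) h <;>
      simp only [Sum.elim_inl, Sum.elim_inr, evenPair, oddPair, Prod.mk.injEq] at h <;>
      simp only [Sum.inl.injEq, Sum.inr.injEq, Prod.mk.injEq, reduceCtorEq] <;> omega
  · rintro ⟨x, y⟩
    rcases Int.emod_two_eq_zero_or_one (x + y) with h | h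
    · exact ⟨.inl ((x + y) / 2, (x - y) / 2), by simp [evenPair]; omega⟩
    · exact ⟨.inr ((x + y - 1) / 2, (x - y - 1) / 2), by simp [oddPair]; omega⟩

/-- φ(q)² = φ(q²)² + 4qψ(q⁴)²: in x² + y² put (x, y) = (a+b, a-b) or (a+b+1, a-b) according to
parity. With the sign (-1)^(x+y) the same split gives φ(-q)². -/
theorem theta_sq_eq : theta 1 1 1 ^ 2 = theta 1 2 2 ^ 2 + X * theta 1 4 0 ^ 2 := by
  rw [sq, sq, sq]
  refine (hasSum_theta_mul 1 1 (by simp) (by simp)).unique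
    (HasSum.of_bijective_sumElim bijective_parity ?_ ?_)
  · refine HasSum.of_forall_eq (hasSum_theta_mul 1 1 (by simp) (by simp)) ?_
    rintro ⟨a, b⟩
    simp only [Function.comp, evenPair, thetaTerm_one, ← pow_add]
    congr 1
    zify
    linarith [two_mul_triangle (a + b), two_mul_triangle (a - b), two_mul_triangle (a + b - 1),
      two_mul_triangle (a - b - 1), two_mul_triangle a, two_mul_triangle b,
      two_mul_triangle (a - 1), two_mul_triangle (b - 1)]
  · refine HasSum.of_forall_eq (HasSum.mul_left X (hasSum_theta_mul 1 1 (by simp) (by simp))) ?_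
    rintro ⟨a, b⟩
    simp only [Function.comp, oddPair, thetaTerm_one, ← pow_add, ← pow_succ']
    congr 1
    zify
    linarith [two_mul_triangle (a + b + 1), two_mul_triangle (a - b), two_mul_triangle (a + b + 1 - 1),
      two_mul_triangle (a - b - 1), two_mul_triangle a, two_mul_triangle b,
      two_mul_triangle (a - 1), two_mul_triangle (b - 1)]

theorem theta_neg_one_sq_eq : theta (-1) 1 1 ^ 2 = theta 1 2 2 ^ 2 - X * theta 1 4 0 ^ 2 := by
  rw [sq, sq, sq, sub_eq_add_neg, ← neg_mul]
  refine (hasSum_theta_mul (-1) (-1) (by simp) (by simp)).unique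
    (HasSum.of_bijective_sumElim bijective_parity ?_ ?_)
  · refine HasSum.of_forall_eq (hasSum_theta_mul 1 1 (by simp) (by simp)) ?_
    rintro ⟨a, b⟩
    simp only [Function.comp, evenPair, thetaTerm_one, thetaTerm_neg_one]
    rw [mul_mul_mul_comm, C_neg_one_zpow_mul, C_neg_one_zpow_of_even (by omega), one_mul,
      ← pow_add, ← pow_add]
    congr 1
    zify
    linarith [two_mul_triangle (a + b), two_mul_triangle (a - b), two_mul_triangle (a + b - 1),
      two_mul_triangle (a - b - 1), two_mul_triangle a, two_mul_triangle b,
      two_mul_triangle (a - 1), two_mul_triangle (b - 1)]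
  · refine HasSum.of_forall_eq (HasSum.mul_left (-X) (hasSum_theta_mul 1 1 (by simp) (by simp))) ?_
    rintro ⟨a, b⟩
    simp only [Function.comp, oddPair, thetaTerm_one, thetaTerm_neg_one]
    rw [mul_mul_mul_comm, C_neg_one_zpow_mul, C_neg_one_zpow_of_odd (by omega), neg_one_mul,
      ← pow_add, ← pow_add, neg_mul, ← pow_succ']
    congr 2
    zify
    linarith [two_mul_triangle (a + b + 1), two_mul_triangle (a - b), two_mul_triangle (a + b + 1 - 1),
      two_mul_triangle (a - b - 1), two_mul_triangle a, two_mul_triangle b,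
      two_mul_triangle (a - 1), two_mul_triangle (b - 1)]

/-- The same parity split; the cross terms in a and b cancel in the sum of the two exponents, so
each class is again a product of two theta series. -/
theorem theta_one_two_sq :
    theta 1 1 2 ^ 2 = theta 1 2 4 * theta 1 3 3 + X * (theta 1 1 5 * theta 1 6 0) := by
  rw [sq, theta_comm 1 (i := 1) (j := 5) (by simp), inv_one]
  refine (hasSum_theta_mul 1 1 (by simp) (by simp)).unique
    (HasSum.of_bijective_sumElim bijective_parity ?_ ?_)
  · refine HasSum.of_forall_eq (hasSum_theta_mul 1 1 (by simp) (by simp)) ?_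
    rintro ⟨a, b⟩
    simp only [Function.comp, evenPair, thetaTerm_one, ← pow_add]
    congr 1
    zify
    linarith [two_mul_triangle (a + b), two_mul_triangle (a - b), two_mul_triangle (a + b - 1),
      two_mul_triangle (a - b - 1), two_mul_triangle a, two_mul_triangle b,
      two_mul_triangle (a - 1), two_mul_triangle (b - 1)]
  · refine HasSum.of_forall_eq (HasSum.mul_left X (hasSum_theta_mul 1 1 (by simp) (by simp))) ?_
    rintro ⟨a, b⟩
    simp only [Function.comp, oddPair, thetaTerm_one, ← pow_add, ← pow_succ']
    congr 1
    zify
    linarith [two_mul_triangle (a + b + 1), two_mul_triangle (a - b), two_mul_triangle (a + b + 1 - 1),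
      two_mul_triangle (a - b - 1), two_mul_triangle a, two_mul_triangle b,
      two_mul_triangle (a - 1), two_mul_triangle (b - 1)]

theorem bijective_two_mul : Function.Bijective
    (Sum.elim (fun n : ℤ => 2 * n) fun n : ℤ => 2 * n + 1) := by
  constructor
  · rintro (a | a) (b | b) h <;> simp only [Sum.elim_inl, Sum.elim_inr] at h <;>
      simp only [Sum.inl.injEq, Sum.inr.injEq, reduceCtorEq] <;> omega
  · intro x
    rcases Int.emod_two_eq_zero_or_one x with h | h
    · exact ⟨.inl (x / 2), by simp; omega⟩
    · exact ⟨.inr (x / 2), by simp; omega⟩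

theorem theta_one_eq_two_dissection : theta 1 1 1 = theta 1 4 4 + X * theta 1 8 0 := by
  refine (hasSum_theta 1 (by simp)).unique (HasSum.of_bijective_sumElim bijective_two_mul ?_ ?_)
  · refine HasSum.of_forall_eq (hasSum_theta 1 (by simp)) ?_
    intro a
    simp only [Function.comp, thetaTerm_one]
    congr 1
    zify
    linarith [two_mul_triangle (2 * a), two_mul_triangle (2 * a - 1), two_mul_triangle a,
      two_mul_triangle (a - 1)]
  · refine HasSum.of_forall_eq (HasSum.mul_left X (hasSum_theta 1 (by simp))) ?_
    intro a
    simp only [Function.comp, thetaTerm_one, ← pow_succ']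
    congr 1
    zify
    linarith [two_mul_triangle (2 * a + 1), two_mul_triangle (2 * a + 1 - 1), two_mul_triangle a,
      two_mul_triangle (a - 1)]

theorem bijective_three_mul : Function.Bijective
    (Sum.elim (fun n : ℤ => 3 * n)
      (Sum.elim (fun n : ℤ => 3 * n - 1) fun n : ℤ => -(3 * n - 1))) := by
  constructor
  · rintro (a | a | a) (b | b | b) h <;> simp only [Sum.elim_inl, Sum.elim_inr] at h <;>
      simp only [Sum.inl.injEq, Sum.inr.injEq, reduceCtorEq] <;> omega
  · intro x
    have h : x % 3 = 0 ∨ x % 3 = 1 ∨ x % 3 = 2 := by omega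
    rcases h with h | h | h
    · exact ⟨.inl (x / 3), by simp; omega⟩
    · exact ⟨.inr (.inr (-(x / 3))), by simp; omega⟩
    · exact ⟨.inr (.inl (x / 3 + 1)), by simp; omega⟩

theorem HasSum.of_bijective_sumElim_three {M ι κ₁ κ₂ κ₃ : Type*} [AddCommMonoid M]
    [TopologicalSpace M] [ContinuousAdd M] {f : ι → M} {g₁ : κ₁ → ι} {g₂ : κ₂ → ι} {g₃ : κ₃ → ι}
    {a b c : M} (hg : Function.Bijective (Sum.elim g₁ (Sum.elim g₂ g₃))) (h₁ : HasSum (f ∘ g₁) a)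
    (h₂ : HasSum (f ∘ g₂) b) (h₃ : HasSum (f ∘ g₃) c) : HasSum f (a + (b + c)) := by
  refine HasSum.of_bijective_sumElim hg h₁ (HasSum.of_bijective_sumElim (g₁ := Sum.inl)
    (g₂ := Sum.inr) ?_ h₂ h₃)
  rw [Sum.elim_inl_inr]
  exact Function.bijective_id

/-- Split the summation index by its residue mod 3; the classes 1 and 2 are exchanged by n ↦ -n and
contribute equally. -/
theorem theta_neg_one_eq_three_dissection :
    theta (-1) 1 1 = theta (-1) 9 9 - 2 * X * theta (-1) 3 15 := by
  have : theta (-1) 9 9 - 2 * X * theta (-1) 3 15 =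
      theta (-1) 9 9 + (-X * theta (-1) 3 15 + -X * theta (-1) 3 15) := by ring
  rw [this]
  have key : ∀ a : ℤ, (thetaTerm (-1) 1 1 (3 * a - 1) : ℤ⟦X⟧) = -X * thetaTerm (-1) 3 15 a := by
    intro a
    simp only [thetaTerm_neg_one]
    rw [neg_one_zpow_eq_neg (m := 3 * a - 1) (n := a) (by omega), Units.val_neg, map_neg, neg_mul,
      neg_mul, mul_left_comm, ← pow_succ']
    congr 3
    zify
    linarith [two_mul_triangle (3 * a - 1), two_mul_triangle (3 * a - 1 - 1), two_mul_triangle a,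
      two_mul_triangle (a - 1)]
  refine (hasSum_theta (-1) (by simp)).unique
    (HasSum.of_bijective_sumElim_three bijective_three_mul ?_ ?_ ?_)
  · refine HasSum.of_forall_eq (hasSum_theta (-1) (by simp)) ?_
    intro a
    simp only [Function.comp, thetaTerm_neg_one]
    rw [neg_one_zpow_eq (m := 3 * a) (n := a) (by omega)]
    congr 2
    zify
    linarith [two_mul_triangle (3 * a), two_mul_triangle (3 * a - 1), two_mul_triangle a,
      two_mul_triangle (a - 1)]
  · exact HasSum.of_forall_eq (HasSum.mul_left (-X) (hasSum_theta (-1) (by simp))) key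
  · refine HasSum.of_forall_eq (HasSum.mul_left (-X) (hasSum_theta (-1) (by simp))) fun a => ?_
    rw [← key a]
    simp only [Function.comp, thetaTerm_neg_one]
    rw [neg_one_zpow_eq (m := -(3 * a - 1)) (n := 3 * a - 1) (by omega)]
    congr 2
    zify
    linarith [two_mul_triangle (3 * a - 1), two_mul_triangle (3 * a - 1 - 1),
      two_mul_triangle (-(3 * a - 1)), two_mul_triangle (-(3 * a - 1) - 1)]

/-- The general term of the binary theta series that accounts for half of `ψ(q) ψ(q ^ 3)`. -/
noncomputable def hexagonalTerm (p : ℤ × ℤ) : ℤ⟦X⟧ :=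
  X ^ (triangle (2 * p.2 - p.1) + 3 * triangle p.1)

/-- The binary theta series that accounts for half of `ψ(q) ψ(q ^ 3)`. -/
noncomputable def hexagonalSeries : ℤ⟦X⟧ := ∑' p, hexagonalTerm p

theorem hasSum_hexagonalTerm : HasSum hexagonalTerm hexagonalSeries := by
  refine Summable.hasSum ?_
  have h : OrderTendsto fun x : ℤ × ℤ => (thetaTerm 1 1 0 x.1 * thetaTerm 1 3 0 x.2 : ℤ⟦X⟧) :=
    (orderTendsto_thetaTerm 1 (by simp)).mul (orderTendsto_thetaTerm 1 (by simp))
  have h2 := h.comp_injective (g := fun p : ℤ × ℤ => (2 * p.2 - p.1, p.1)) fun p q hpq => by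
    simp only [Prod.mk.injEq] at hpq
    ext <;> omega
  convert h2.summable using 1
  ext1 p
  simp [thetaTerm_one, hexagonalTerm, pow_add]

/-- The reflection x ↦ -x-1 fixes x(x+1)/2 and flips the parity of x, so pairs of equal and of
different parity contribute the same. The reparametrizations bring both to the form 2(a² - ab + b²)
+ a + b, which is symmetric in a and b. -/
theorem theta_mul_theta_eq_two_mul_hexagonalSeries :
    theta 1 1 0 * theta 1 3 0 = 2 * hexagonalSeries := by
  rw [two_mul]
  refine (hasSum_theta_mul 1 1 (by simp) (by simp)).unique
    (HasSum.of_bijective_sumElim bijective_parity ?_ ?_)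
  · let e : ℤ × ℤ ≃ ℤ × ℤ :=
      { toFun := fun p => (p.2, p.2 - p.1)
        invFun := fun p => (p.1 - p.2, p.1)
        left_inv := fun p => by ext <;> simp
        right_inv := fun p => by ext <;> simp }
    rw [← e.hasSum_iff]
    refine HasSum.of_forall_eq hasSum_hexagonalTerm ?_
    rintro ⟨a, b⟩
    simp only [Function.comp, evenPair, thetaTerm_one, ← pow_add, e, Equiv.coe_fn_mk, hexagonalTerm]
    congr 1
    zify
    linarith [two_mul_triangle (b + (b - a)), two_mul_triangle (b - (b - a)), two_mul_triangle a,
      two_mul_triangle (2 * b - a)]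
  · let e : ℤ × ℤ ≃ ℤ × ℤ :=
      { toFun := fun p => (p.2 - p.1 - 1, -p.1 - 1)
        invFun := fun p => (-p.2 - 1, p.1 - p.2)
        left_inv := fun p => by ext <;> (dsimp only; omega)
        right_inv := fun p => by ext <;> (dsimp only; omega) }
    rw [← e.hasSum_iff]
    refine HasSum.of_forall_eq hasSum_hexagonalTerm ?_
    rintro ⟨a, b⟩
    simp only [Function.comp, oddPair, thetaTerm_one, ← pow_add, e, Equiv.coe_fn_mk, hexagonalTerm]
    congr 1
    zify
    linarith [two_mul_triangle (b - a - 1 + (-a - 1) + 1), two_mul_triangle (b - a - 1 - (-a - 1)),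
      two_mul_triangle a, two_mul_triangle (2 * b - a)]

/-- For x = a+b+1 and y = a-b, x² + 3y² = 1 + 2(2(a² - ab + b²) + a + b): the odd-parity part of
φ(q)φ(q³) is governed by the same hexagonal form. -/
theorem expand_hexagonalTerm (p : ℤ × ℤ) : X * expand 2 two_ne_zero (hexagonalTerm p) =
    thetaTerm 1 1 1 (oddPair p).1 * thetaTerm 1 3 3 (oddPair p).2 := by
  obtain ⟨a, b⟩ := p
  simp only [oddPair, thetaTerm_one, ← pow_add, hexagonalTerm, map_pow, expand_X, ← pow_mul,
    ← pow_succ']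
  congr 1
  zify
  linarith [two_mul_triangle (a + b + 1), two_mul_triangle (a - b), two_mul_triangle (a + b + 1 - 1),
      two_mul_triangle (a - b - 1), two_mul_triangle a, two_mul_triangle (2 * b - a)]

theorem hasSum_oddPair_theta_mul : HasSum
    ((fun x : ℤ × ℤ => (thetaTerm 1 1 1 x.1 * thetaTerm 1 3 3 x.2 : ℤ⟦X⟧)) ∘ oddPair)
    (X * expand 2 two_ne_zero hexagonalSeries) :=
  HasSum.of_forall_eq (HasSum.mul_left X (hasSum_hexagonalTerm.map
    (expand 2 two_ne_zero : ℤ⟦X⟧ →ₐ[ℤ] ℤ⟦X⟧) (continuous_expand two_ne_zero)))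
    fun p => (expand_hexagonalTerm p).symm

/-- Changing the sign of q fixes the terms of φ(q)φ(q³) with x ≡ y mod 2 and negates the others, so
the difference is twice the odd-parity part, that is 4qψ(q²)ψ(q⁶). -/
theorem theta_one_three_sub :
    theta 1 1 1 * theta 1 3 3 - theta (-1) 1 1 * theta (-1) 3 3 =
      X * (theta 1 2 0 * theta 1 6 0) := by
  have hs : OrderTendsto fun x : ℤ × ℤ => (thetaTerm 1 1 1 x.1 * thetaTerm 1 3 3 x.2 : ℤ⟦X⟧) :=
    (orderTendsto_thetaTerm 1 (by simp)).mul (orderTendsto_thetaTerm 1 (by simp))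
  have hA := (hs.comp_injective (g := evenPair)
    (bijective_parity.1.comp Sum.inl_injective)).summable.hasSum
  have h1 := (hasSum_theta_mul 1 1 (by simp) (by simp)).unique
    (HasSum.of_bijective_sumElim bijective_parity hA hasSum_oddPair_theta_mul)
  have h2 := (hasSum_theta_mul (-1) (-1) (i := 1) (j := 1) (k := 3) (l := 3) (by simp)
    (by simp)).unique (HasSum.of_bijective_sumElim bijective_parity
      (HasSum.of_forall_eq hA (g := _) ?_) (HasSum.of_forall_eq hasSum_oddPair_theta_mul.neg ?_))
  · have h3 := congrArg (expand 2 two_ne_zero) theta_mul_theta_eq_two_mul_hexagonalSeries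
    simp only [map_mul, map_ofNat] at h3
    rw [expand_theta _ (by simp), expand_theta _ (by simp)] at h3
    norm_num at h3
    rw [h1, h2, h3]
    ring
  · rintro ⟨a, b⟩
    simp only [Function.comp, evenPair, thetaTerm_one, thetaTerm_neg_one]
    rw [mul_mul_mul_comm, C_neg_one_zpow_mul, C_neg_one_zpow_of_even (by omega), one_mul]
  · rintro ⟨a, b⟩
    simp only [Function.comp, oddPair, thetaTerm_one, thetaTerm_neg_one]
    rw [mul_mul_mul_comm, C_neg_one_zpow_mul, C_neg_one_zpow_of_odd (by omega), neg_one_mul]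

/-- Terms with x ≢ y give the hexagonal series at -q², because its exponent has the parity of a + b.
Terms with x ≡ y split once more into both even and both odd, giving φ(q⁴)φ(q¹²) - 4q⁴ψ(q⁸)ψ(q²⁴),
which `theta_one_three_sub` at q⁴ recognizes as φ(-q⁴)φ(-q¹²). -/
theorem theta_one_mul_theta_neg_three :
    theta 1 1 1 * theta (-1) 3 3 = theta (-1) 4 4 * theta (-1) 12 12 +
      X * expand 2 two_ne_zero (rescale (-1) hexagonalSeries) := by
  have h1 := congrArg (expand 4 four_ne_zero) theta_one_three_sub
  simp only [map_mul, map_sub, expand_X] at h1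
  iterate 6 rw [expand_theta _ (by simp)] at h1
  norm_num at h1
  have h2 : theta (-1) 4 4 * theta (-1) 12 12 =
      theta 1 4 4 * theta 1 12 12 + -X ^ 4 * (theta 1 8 0 * theta 1 24 0) := by
    linear_combination -h1
  rw [h2]
  have hodd : HasSum ((fun x : ℤ × ℤ => (thetaTerm 1 1 1 x.1 * thetaTerm (-1) 3 3 x.2 : ℤ⟦X⟧)) ∘
      oddPair) (X * expand 2 two_ne_zero (rescale (-1) hexagonalSeries)) := by
    refine HasSum.of_forall_eq (HasSum.mul_left X ((hasSum_hexagonalTerm.map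
      (rescale (-1) : ℤ⟦X⟧ →+* ℤ⟦X⟧) (continuous_rescale (-1))).map
        (expand 2 two_ne_zero : ℤ⟦X⟧ →ₐ[ℤ] ℤ⟦X⟧) (continuous_expand two_ne_zero))) fun p => ?_
    have h := expand_hexagonalTerm p
    obtain ⟨a, b⟩ := p
    simp only [Function.comp]
    have h3 : rescale (-1 : ℤ) (hexagonalTerm (a, b)) =
        C (((-1 : ℤˣ) ^ (a - b) : ℤˣ) : ℤ) * hexagonalTerm (a, b) := by
      simp only [hexagonalTerm, map_pow, rescale_X, map_neg, map_one]
      rw [neg_one_mul, neg_pow]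
      congr 1
      obtain ⟨s, h4⟩ : ∃ s : ℤ, ((triangle (2 * b - a) + 3 * triangle a : ℕ) : ℤ) =
          2 * s + a + b := by
        refine ⟨a ^ 2 - a * b + b ^ 2, ?_⟩
        push_cast
        linarith [two_mul_triangle a, two_mul_triangle (2 * b - a)]
      rw [neg_one_zpow_eq (n := ((triangle (2 * b - a) + 3 * triangle a : ℕ) : ℤ)) (by omega), zpow_natCast,
        Units.val_pow_eq_pow_val]
      simp
    rw [h3, map_mul, expand_C, mul_left_comm, h]
    simp only [oddPair, thetaTerm_one, thetaTerm_neg_one]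
    ring
  refine (hasSum_theta_mul 1 (-1) (by simp) (by simp)).unique
    (HasSum.of_bijective_sumElim bijective_parity
      (HasSum.of_bijective_sumElim bijective_parity ?_ ?_) hodd)
  · refine HasSum.of_forall_eq (hasSum_theta_mul 1 1 (by simp) (by simp)) ?_
    rintro ⟨a, b⟩
    simp only [Function.comp, evenPair, thetaTerm_one, thetaTerm_neg_one]
    rw [C_neg_one_zpow_of_even (by omega), one_mul (X ^ _ : ℤ⟦X⟧), ← pow_add, ← pow_add]
    congr 1
    zify
    ring_nf
    linarith [two_mul_triangle (a * 2), two_mul_triangle (-1 + a * 2), two_mul_triangle (b * 2),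
      two_mul_triangle (-1 + b * 2), two_mul_triangle a, two_mul_triangle (-1 + a),
      two_mul_triangle b, two_mul_triangle (-1 + b)]
  · refine HasSum.of_forall_eq
      (HasSum.mul_left (-X ^ 4) (hasSum_theta_mul 1 1 (by simp) (by simp))) ?_
    rintro ⟨a, b⟩
    simp only [Function.comp, evenPair, oddPair, thetaTerm_one, thetaTerm_neg_one]
    rw [C_neg_one_zpow_of_odd (by omega), neg_one_mul, mul_neg, neg_mul, ← pow_add, ← pow_add,
      ← pow_add]
    congr 2
    zify
    ring_nf
    linarith [two_mul_triangle (a * 2), two_mul_triangle (1 + a * 2), two_mul_triangle (b * 2),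
      two_mul_triangle (1 + b * 2), two_mul_triangle a, two_mul_triangle b]

end Dissections

/-! ### Differentiation in the parameter through dual numbers -/

section DualNumber

open TrivSqZeroExt

variable {A : Type*} [CommRing A]

/-- The unit `1 + a ε` of the dual numbers, as a homomorphism from the additive group. -/
noncomputable def dualUnit : Multiplicative A →* (DualNumber A)ˣ where
  toFun a := ⟨1 + inr a.toAdd, 1 - inr a.toAdd, by ext <;> simp, by ext <;> simp⟩
  map_one' := by ext <;> simp
  map_mul' a b := by ext <;> simp [add_comm]

theorem dualUnit_one_zpow (n : ℤ) :
    (((dualUnit (.ofAdd (1 : A))) ^ n : (DualNumber A)ˣ) : DualNumber A) = 1 + inr (n : A) := by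
  rw [← map_zpow, ← ofAdd_zsmul]
  simp [dualUnit]

/-- The unit `w (1 + ε)` of the dual numbers. -/
noncomputable def dualLift (w : Aˣ) : (DualNumber A)ˣ :=
  Units.map (inlHom A A).toMonoidHom w * dualUnit (.ofAdd 1)

theorem dualLift_zpow (w : Aˣ) (n : ℤ) :
    ((dualLift w ^ n : (DualNumber A)ˣ) : DualNumber A) =
      inl ((w ^ n : Aˣ) : A) + inr (((w ^ n : Aˣ) : A) * n) := by
  have h : dualLift w ^ n = Units.map (inlHom A A).toMonoidHom (w ^ n) * dualUnit (.ofAdd 1) ^ n := by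
    rw [map_zpow]
    exact (show Commute _ _ from Units.ext (mul_comm _ _)).mul_zpow n
  have h2 : ((Units.map (inlHom A A).toMonoidHom (w ^ n) : (DualNumber A)ˣ) : DualNumber A) =
      inl ((w ^ n : Aˣ) : A) := rfl
  rw [h, Units.val_mul, dualUnit_one_zpow, h2]
  ext <;> simp

/-- The derivation part of a power series over the dual numbers. -/
noncomputable def sndSeries : (DualNumber A)⟦X⟧ →+ A⟦X⟧ where
  toFun f := PowerSeries.mk fun n => (coeff n f).snd
  map_zero' := by ext; simp
  map_add' f g := by ext; simp

@[simp] theorem coeff_sndSeries (f : (DualNumber A)⟦X⟧) (n : ℕ) :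
    coeff n (sndSeries f) = (coeff n f).snd := by
  simp [sndSeries]

/-- The Leibniz rule: taking the ε-part is a derivation over reduction modulo ε. -/
theorem sndSeries_mul (f g : (DualNumber A)⟦X⟧) : sndSeries (f * g) =
    PowerSeries.map (fstHom A A A).toRingHom f * sndSeries g +
      sndSeries f * PowerSeries.map (fstHom A A A).toRingHom g := by
  ext n
  simp only [coeff_sndSeries, map_add, coeff_mul, coeff_map, snd_sum, ← Finset.sum_add_distrib]
  refine Finset.sum_congr rfl fun x _ => ?_
  simp [mul_comm]

theorem sndSeries_thetaTerm (w : Aˣ) (i j : ℕ) (n : ℤ) :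
    sndSeries (thetaTerm (dualLift w) i j n) =
      C (((w ^ n : Aˣ) : A) * n) * X ^ (i * triangle n + j * triangle (n - 1)) := by
  ext m
  rw [coeff_sndSeries, thetaTerm, coeff_C_mul, coeff_C_mul, dualLift_zpow, coeff_X_pow, coeff_X_pow]
  split_ifs <;> simp

variable [TopologicalSpace A]

theorem continuous_sndSeries : Continuous (sndSeries : (DualNumber A)⟦X⟧ → A⟦X⟧) := by
  refine continuous_of_continuous_coeff fun n => ?_
  simp only [coeff_sndSeries]
  exact TrivSqZeroExt.continuous_snd.comp (WithPiTopology.continuous_coeff _ n)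

theorem progProd_neg_one_dual (i k : ℕ) :
    (progProd (-1) i k : (DualNumber A)⟦X⟧) = progProd (inl (-1)) i k := by simp

variable [T2Space A]

theorem map_fst_progProd (c : DualNumber A) (i : ℕ) {k : ℕ} (hk : 0 < k) :
    PowerSeries.map (fstHom A A A).toRingHom (progProd c i k) = progProd c.fst i k :=
  map_progProd TrivSqZeroExt.continuous_fst c i hk

theorem sndSeries_progProd_of_snd_eq_zero (c : A) (i : ℕ) {k : ℕ} (hk : 0 < k) :
    sndSeries (progProd (inl c : DualNumber A) i k) = 0 := by
  have h := map_progProd (φ := (inlHom A A)) continuous_inl c i hk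
  rw [inlHom_apply] at h
  rw [← h]
  ext n
  simp

variable [IsTopologicalRing A]

/-- The derivative of the triple product identity with respect to the parameter. -/
theorem hasSum_derivative_thetaTerm (w : Aˣ) (i j : ℕ) {k : ℕ} (hij : i + j = k)
    (hk : 0 < k) :
    HasSum (fun n : ℤ =>
        (C (((w ^ n : Aˣ) : A) * n) * X ^ (i * triangle n + j * triangle (n - 1)) : A⟦X⟧))
      (sndSeries (progProd (-1) k k * (progProd (dualLift w : DualNumber A) i k *
        progProd (((dualLift w)⁻¹ : (DualNumber A)ˣ) : DualNumber A) j k))) :=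
  HasSum.of_forall_eq ((hasSum_thetaTerm_progProd (dualLift w) i j hij hk).map sndSeries
    continuous_sndSeries) fun n => (sndSeries_thetaTerm w i j n).symm

end DualNumber

/-! ### Jacobi's cube identity and the series ∑ (3n+1) q^(3n²+2n) -/

section Jacobi

open TrivSqZeroExt

/-- Jacobi's identity for the cube of the Euler product. -/
theorem hasSum_eulerProd_one_cube : HasSum
    (fun n : ℤ => (C ((((-1 : ℤˣ) ^ n : ℤˣ) : ℤ) * n) * X ^ (triangle n) : ℤ⟦X⟧))
    (eulerProd 1 ^ 3) := by
  have h := hasSum_derivative_thetaTerm (-1 : ℤˣ) 1 0 (k := 1) rfl one_pos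
  have hu : (((dualLift (-1 : ℤˣ))⁻¹ : (DualNumber ℤ)ˣ) : DualNumber ℤ) = inl (-1) + inr 1 := by
    have := dualLift_zpow (-1 : ℤˣ) (-1)
    rw [zpow_neg_one] at this
    rw [this]; simp
  have hu' : ((dualLift (-1 : ℤˣ) : (DualNumber ℤ)ˣ) : DualNumber ℤ) = inl (-1) + inr (-1) := by
    have := dualLift_zpow (-1 : ℤˣ) 1
    rw [zpow_one] at this
    rw [this]; simp
  rw [hu, hu', progProd_zero_eq _ one_pos, sndSeries_mul, sndSeries_mul, sndSeries_mul] at h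
  -- At u = -(1+ε) the factor 1 + u⁻¹ of the product equals ε. Only this factor is differentiated;
  -- the rest is evaluated at u = -1, which leaves three Euler products.
  have h0 : (1 : (DualNumber ℤ)⟦X⟧) + C (inl (-1) + inr 1) = C (inr 1) := by
    rw [← map_one C, ← map_add]
    congr 1
  have h1 : PowerSeries.map (fstHom ℤ ℤ ℤ).toRingHom (C (inr 1)) = 0 := by
    rw [map_C]; simp
  have h2 : sndSeries (C (inr 1) : (DualNumber ℤ)⟦X⟧) = 1 := by
    ext n
    rw [coeff_sndSeries, coeff_C, coeff_one]
    split_ifs <;> simp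
  rw [h0, map_mul, map_mul, h1, h2, progProd_neg_one_dual, map_fst_progProd _ _ one_pos,
    map_fst_progProd _ _ one_pos, map_fst_progProd _ _ one_pos,
    sndSeries_progProd_of_snd_eq_zero _ _ one_pos] at h
  simp only [fst_inl, fst_add, fst_inr, add_zero, zero_mul, zero_add, mul_zero, one_mul] at h
  rw [show eulerProd 1 ^ 3 = eulerProd 1 * (eulerProd 1 * eulerProd 1) by ring]
  exact h

theorem powerSeries_two_ne_zero : (2 : ℤ⟦X⟧) ≠ 0 := fun h => by
  have := congrArg constantCoeff h
  rw [map_ofNat, map_zero] at this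
  exact absurd this (by norm_num)

theorem HasSum.eq_zero_of_antisymm {ι : Type*} {f : ι → ℤ⟦X⟧} {a : ℤ⟦X⟧} (hf : HasSum f a)
    (e : ι ≃ ι) (h : ∀ x, f (e x) = -f x) : a = 0 := by
  have h1 := (e.hasSum_iff).mpr hf
  have h2 := h1.unique (HasSum.of_forall_eq hf.neg h)
  have h3 : (2 : ℤ⟦X⟧) * a = 0 := by linear_combination h2
  exact (mul_eq_zero.mp h3).resolve_left powerSeries_two_ne_zero

/-- The general term of `∑ (3 n + 1) q ^ (3 n ^ 2 + 2 n)`. -/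
noncomputable def quintupleTerm (n : ℤ) : ℤ⟦X⟧ :=
  C (3 * n + 1) * X ^ (5 * triangle n + 1 * triangle (n - 1))

/-- The series `∑ (3 n + 1) q ^ (3 n ^ 2 + 2 n)`. -/
noncomputable def quintupleSeries : ℤ⟦X⟧ := ∑' n, quintupleTerm n

theorem orderTendsto_quintupleTerm : OrderTendsto quintupleTerm :=
  OrderTendsto.of_finite (finite_theta_exponent_lt (by simp)) _

theorem hasSum_quintupleTerm : HasSum quintupleTerm quintupleSeries :=
  orderTendsto_quintupleTerm.summable.hasSum

/-- The three maps parametrize the pairs (n, m) with m - n ≡ 0, 2, 1 mod 3, in this order. The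
second is the first followed by (n, m) ↦ (-n, -m-1). -/
theorem bijective_mod_three_pair : Function.Bijective
    (Sum.elim (fun p : ℤ × ℤ => (p.2 - 2 * p.1, p.1 + p.2))
      (Sum.elim (fun p : ℤ × ℤ => (-(p.2 - 2 * p.1), -(p.1 + p.2) - 1))
        fun p : ℤ × ℤ => (p.2 - 2 * p.1 - 1, p.1 + p.2))) := by
  constructor
  · rintro (⟨a, b⟩ | ⟨a, b⟩ | ⟨a, b⟩) (⟨c, d⟩ | ⟨c, d⟩ | ⟨c, d⟩) h <;>
      simp only [Sum.elim_inl, Sum.elim_inr, Prod.mk.injEq] at h <;>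
      simp only [Sum.inl.injEq, Sum.inr.injEq, Prod.mk.injEq, reduceCtorEq] <;> omega
  · rintro ⟨n, m⟩
    have h : (m - n) % 3 = 0 ∨ (m - n) % 3 = 1 ∨ (m - n) % 3 = 2 := by omega
    rcases h with h | h | h
    · exact ⟨.inl ((m - n) / 3, m - (m - n) / 3), by simp; omega⟩
    · exact ⟨.inr (.inr ((m - n) / 3, m - (m - n) / 3)), by simp; omega⟩
    · exact ⟨.inr (.inl (-((m - n) / 3 + 1), -m - 1 + ((m - n) / 3 + 1))), by simp; omega⟩

theorem theta_neg_one_eight_four : theta (-1) 8 4 = eulerProd 4 := by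
  rw [theta_eq (-1) 8 4 12 rfl (by norm_num), eulerProd, progProd_three _ 4 four_pos]
  simp only [inv_neg, inv_one, Units.val_neg, Units.val_one]
  ring_nf

theorem theta_neg_one_four_zero : theta (-1) 4 0 = 0 := by
  rw [theta_eq (-1) 4 0 4 rfl four_pos]
  simp [progProd_zero_eq _ four_pos]

/-- Multiply ∑ (-1)^n q^(n²) by Jacobi's series for f_4³ and replace the weight 2m by 2m+1+n, which
does not change the sum. In the class n = l-2j, m = l+j the weight is 3l+1 and the exponent
separates as (3l²+2l) + (6j²+2j), which gives the desired series times Euler's pentagonal series for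
f_4. -/
theorem theta_neg_one_mul_eulerProd_four_cube :
    theta (-1) 1 1 * eulerProd 4 ^ 3 = eulerProd 4 * quintupleSeries := by
  set A : ℤ → ℤ⟦X⟧ := fun m => C ((((-1 : ℤˣ) ^ m : ℤˣ) : ℤ) * m) * X ^ (4 * triangle m) with hA
  have hAsum : HasSum A (eulerProd 4 ^ 3) := by
    have h := hasSum_eulerProd_one_cube.map (expand 4 four_ne_zero : ℤ⟦X⟧ →ₐ[ℤ] ℤ⟦X⟧)
      (continuous_expand four_ne_zero)
    rw [map_pow, expand_eulerProd one_pos] at h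
    refine HasSum.of_forall_eq h fun m => ?_
    simp only [hA, Function.comp, map_mul, expand_C, map_pow, expand_X, ← pow_mul]
  have hAt : OrderTendsto A := by
    have h := finite_theta_exponent_lt (i := 4) (j := 0) (by simp)
    simp only [zero_mul, add_zero] at h
    exact OrderTendsto.of_finite h _
  have hBt : OrderTendsto (thetaTerm (-1 : ℤˣ) 1 1) := orderTendsto_thetaTerm (-1) (by simp)
  have hB't : OrderTendsto fun n : ℤ => (C n * thetaTerm (-1) 1 1 n : ℤ⟦X⟧) := hBt.mul_left _
  have h1 := (hasSum_theta (-1) (i := 1) (j := 1) (by simp)).mul_of_orderTendsto hAsum hBt hAt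
  have h2 := hasSum_theta_mul (-1) (-1) (i := 1) (j := 1) (k := 4) (l := 0) (by simp) (by simp)
  have h3 := hB't.summable.hasSum.mul_of_orderTendsto
    (hasSum_theta (-1) (i := 4) (j := 0) (by simp)) hB't (orderTendsto_thetaTerm (-1) (by simp))
  -- Both added double series have the factor ∑ (-1)^m q^(2m(m+1)), which is zero by m ↦ -m-1.
  have htot := ((HasSum.mul_left 2 h1).add h2).add h3
  rw [theta_neg_one_four_zero, mul_zero, mul_zero, add_zero, add_zero] at htot
  set f : ℤ × ℤ → ℤ⟦X⟧ := fun p => C ((((-1 : ℤˣ) ^ (p.1 + p.2) : ℤˣ) : ℤ) * (2 * p.2 + 1 + p.1)) *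
    X ^ (triangle p.1 + triangle (p.1 - 1) + 4 * triangle p.2) with hf
  have hft : HasSum f (2 * (theta (-1) 1 1 * eulerProd 4 ^ 3)) := by
    refine HasSum.of_forall_eq htot ?_
    rintro ⟨n, m⟩
    simp only [hf, hA, thetaTerm_neg_one, zpow_add, Units.val_mul, map_mul, map_add, map_one,
      map_ofNat, pow_add, one_mul, zero_mul, pow_zero]
    ring
  have hfo : OrderTendsto f := by
    have h4 : OrderTendsto fun x : ℤ × ℤ => (thetaTerm 1 1 1 x.1 * thetaTerm 1 4 0 x.2 : ℤ⟦X⟧) :=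
      (orderTendsto_thetaTerm 1 (by simp)).mul (orderTendsto_thetaTerm 1 (by simp))
    convert h4.mul_left fun p : ℤ × ℤ =>
      C ((((-1 : ℤˣ) ^ (p.1 + p.2) : ℤˣ) : ℤ) * (2 * p.2 + 1 + p.1)) using 2 with p
    simp only [hf, thetaTerm_one, ← pow_add]
    congr 2
    ring
  have key := (hasSum_theta (-1) (i := 8) (j := 4) (by simp)).mul_of_orderTendsto
    hasSum_quintupleTerm (orderTendsto_thetaTerm (-1) (by simp)) orderTendsto_quintupleTerm
  rw [theta_neg_one_eight_four] at key
  have hg₃ : Function.Injective fun p : ℤ × ℤ => (p.2 - 2 * p.1 - 1, p.1 + p.2) :=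
    bijective_mod_three_pair.1.comp (Sum.inr_injective.comp Sum.inr_injective)
  have h₃ := (hfo.comp_injective hg₃).summable.hasSum
  -- In this class the weight is 3l while sign and exponent are even in l, so the sum cancels.
  have h0 := h₃.eq_zero_of_antisymm ((Equiv.refl ℤ).prodCongr (Equiv.neg ℤ)) (by
    rintro ⟨j, l⟩
    simp only [Function.comp, hf, Equiv.prodCongr_apply, Prod.map, Equiv.refl_apply,
      Equiv.neg_apply]
    rw [neg_one_zpow_eq (m := -l - 2 * j - 1 + (j + -l)) (n := l - 2 * j - 1 + (j + l)) (by omega),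
      ← neg_mul, ← map_neg]
    congr 2
    · ring_nf
    · zify
      linarith [two_mul_triangle (-l - 2 * j - 1), two_mul_triangle (-l - 2 * j - 1 - 1),
        two_mul_triangle (j + -l), two_mul_triangle (l - 2 * j - 1),
        two_mul_triangle (l - 2 * j - 1 - 1), two_mul_triangle (j + l)])
  -- The reflection negates both the weight and the sign, so the first two classes agree and account
  -- for the factor 2.
  have hsplit := hft.unique (HasSum.of_bijective_sumElim_three bijective_mod_three_pair
    (HasSum.of_forall_eq key ?_) (HasSum.of_forall_eq key ?_) h₃)
  · rw [h0, add_zero, ← two_mul] at hsplit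
    exact mul_left_cancel₀ powerSeries_two_ne_zero hsplit
  · rintro ⟨j, l⟩
    simp only [Function.comp, hf, thetaTerm_neg_one, quintupleTerm]
    rw [neg_one_zpow_eq (m := l - 2 * j + (j + l)) (n := j) (by omega), mul_mul_mul_comm, ← map_mul,
      ← pow_add]
    congr 2
    · ring_nf
    · zify
      linarith [two_mul_triangle (l - 2 * j), two_mul_triangle (l - 2 * j - 1),
        two_mul_triangle (j + l), two_mul_triangle l, two_mul_triangle (l - 1),
        two_mul_triangle j, two_mul_triangle (j - 1)]
  · rintro ⟨j, l⟩
    simp only [Function.comp, hf, thetaTerm_neg_one, quintupleTerm]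
    rw [neg_one_zpow_eq_neg (m := -(l - 2 * j) + (-(j + l) - 1)) (n := j) (by omega),
      mul_mul_mul_comm, ← map_mul, ← pow_add]
    congr 2
    · rw [Units.val_neg]; ring_nf
    · zify
      linarith [two_mul_triangle (-(l - 2 * j)), two_mul_triangle (-(l - 2 * j) - 1),
        two_mul_triangle (-(j + l) - 1), two_mul_triangle l, two_mul_triangle (l - 1),
        two_mul_triangle j, two_mul_triangle (j - 1)]

end Jacobi

theorem HasProd.of_forall_eq {M ι : Type*} [CommMonoid M] [TopologicalSpace M] {f g : ι → M} {a : M}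
    (hf : HasProd f a) (h : ∀ x, g x = f x) : HasProd g a := (funext h : g = f) ▸ hf

/-! ### The weighted generating function of partitions into odd parts with tags -/

section Counting

theorem PDOt_eq_sum_partitions (n : ℕ) : PDOt n = ∑ p : n.Partition,
    if ∀ i ∈ p.parts, Odd i then p.parts.toFinset.card * ∏ i ∈ p.parts.toFinset, p.parts.count i
    else 0 := by
  unfold PDOt
  rw [Finset.sum_filter]
  simp_rw [DesignatedPartition.card_taggedParts]
  refine (Fintype.sum_sigma
    (fun d : (Σ p : n.Partition, ∀ i : p.parts.toFinset, Fin (p.parts.count (i : ℕ))) =>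
      if ∀ i ∈ d.1.parts, Odd i then d.1.parts.toFinset.card else 0)).trans ?_
  refine Finset.sum_congr rfl fun p _ => ?_
  by_cases h : ∀ i ∈ p.parts, Odd i
  · simp only [if_pos h]
    rw [Finset.sum_const, Finset.card_univ, Fintype.card_pi, smul_eq_mul, mul_comm]
    simp only [Fintype.card_fin]
    rw [Finset.prod_coe_sort p.parts.toFinset fun i => p.parts.count i]
  · simp only [if_neg h, Finset.sum_const_zero]

variable {R : Type*} [CommRing R]

/-- The weight of a part size: `z` for the tagged part and a factor for the choice of the tag. -/
noncomputable def tagWeight (z : R) (i c : ℕ) : R := if Odd i then z * c else 0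

theorem prod_tagWeight (z : R) {n : ℕ} (p : n.Partition) :
    p.parts.toFinsupp.prod (tagWeight z) = if ∀ i ∈ p.parts, Odd i then
      z ^ p.parts.toFinset.card * ((∏ i ∈ p.parts.toFinset, p.parts.count i : ℕ) : R) else 0 := by
  rw [Finsupp.prod, Multiset.toFinsupp_support]
  simp only [Multiset.toFinsupp_apply]
  split_ifs with h
  · rw [Nat.cast_prod, ← Finset.prod_const, ← Finset.prod_mul_distrib]
    refine Finset.prod_congr rfl fun i hi => ?_
    rw [tagWeight, if_pos (h i (Multiset.mem_toFinset.mp hi))]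
  · push Not at h
    obtain ⟨i, hi, h⟩ := h
    refine Finset.prod_eq_zero (Multiset.mem_toFinset.mpr hi) ?_
    rw [tagWeight, if_neg (by simpa using h)]

variable [TopologicalSpace R] [IsTopologicalRing R] [T2Space R]

theorem one_sub_X_pow_sq_mul_tsum (i : ℕ) :
    (1 - (X : R⟦X⟧) ^ (i + 1)) ^ 2 * ∑' j : ℕ, ((j + 1 : ℕ) : R) • (X : R⟦X⟧) ^ ((i + 1) * (j + 1)) =
      X ^ (i + 1) := by
  set x : R⟦X⟧ := X ^ (i + 1) with hx
  have hx0 : constantCoeff x = 0 := by simp [hx]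
  have hfin : ∀ d, {j : ℕ | (i + 1) * j < d}.Finite := fun d =>
    (Set.finite_Iio d).subset fun j hj => by
      have : j ≤ (i + 1) * j := Nat.le_mul_of_pos_left _ i.succ_pos
      simp only [Set.mem_ofPred_eq] at hj
      simp only [Set.mem_Iio]
      omega
  have h1 : HasSum (fun j : ℕ => (j : R⟦X⟧) * x ^ j) (∑' j : ℕ, (j : R⟦X⟧) * x ^ j) := by
    refine Summable.hasSum ?_
    simp only [hx, ← pow_mul]
    exact (OrderTendsto.of_finite hfin _).summable
  set a := ∑' j : ℕ, (j : R⟦X⟧) * x ^ j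
  have h2 : HasSum (fun j : ℕ => ((j + 1 : ℕ) : R⟦X⟧) * x ^ (j + 1)) a := by
    have := (hasSum_nat_add_iff' 1).mpr h1
    simpa using this
  have h3 := WithPiTopology.tsum_pow_mul_one_sub_of_constantCoeff_eq_zero hx0
  have h4 := (WithPiTopology.summable_pow_of_constantCoeff_eq_zero hx0).hasSum
  set b := ∑' j : ℕ, x ^ j
  have h5 : (1 - x) * a = x * b := by
    have h6 := (HasSum.mul_left x h4).unique (HasSum.of_forall_eq (h2.sub (HasSum.mul_left x h1))
      fun j => by push_cast; ring)
    rw [h6]; ring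
  have h7 : ∑' j : ℕ, ((j + 1 : ℕ) : R) • (X : R⟦X⟧) ^ ((i + 1) * (j + 1)) = a := by
    rw [← h2.tsum_eq]
    congr 1
    ext1 j
    rw [smul_eq_C_mul, map_natCast, hx, ← pow_mul]
  rw [h7]
  linear_combination (1 - x) * h5 + x * h3

/-- Factor by factor: ∑ c x^c = x/(1-x)², and (1-x)² + zx = (1+ux)(1+u⁻¹x) exactly for this z. The
product index i stands for the part size i+1, so even indices carry the odd parts. -/
theorem genFun_tagWeight_mul (u : Rˣ) (z : R) (hz : z = u + ((u⁻¹ : Rˣ) : R) + 2) :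
    Nat.Partition.genFun (tagWeight z) * progProd (-1) 1 2 ^ 2 =
      progProd (u : R) 1 2 * progProd ((u⁻¹ : Rˣ) : R) 1 2 := by
  have h1 := Nat.Partition.hasProd_genFun (tagWeight z)
  have hs : HasProd (fun i : ℕ => if Even i then (1 - (X : R⟦X⟧) ^ (i + 1)) ^ 2 else 1)
      (progProd (-1) 1 2 ^ 2 * 1) := by
    refine HasProd.even_mul_odd ?_ ?_
    · rw [sq]
      convert (hasProd_progProd (-1 : R) 1 two_pos).mul (hasProd_progProd (-1 : R) 1 two_pos) using 2 with k
      simp only [even_two, Even.mul_right, if_true, map_neg, map_one]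
      ring
    · simp [hasProd_one]
  have hr : HasProd (fun i : ℕ => if Even i then (1 + C (u : R) * (X : R⟦X⟧) ^ (i + 1)) *
      (1 + C ((u⁻¹ : Rˣ) : R) * X ^ (i + 1)) else 1)
      (progProd (u : R) 1 2 * progProd ((u⁻¹ : Rˣ) : R) 1 2 * 1) := by
    refine HasProd.even_mul_odd ?_ ?_
    · convert (hasProd_progProd (u : R) 1 two_pos).mul
        (hasProd_progProd ((u⁻¹ : Rˣ) : R) 1 two_pos) using 2 with k
      simp only [even_two, Even.mul_right, if_true, add_comm]
    · simp [hasProd_one]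
  rw [mul_one] at hs hr
  refine (h1.mul hs).unique ?_
  refine HasProd.of_forall_eq hr fun i => ?_
  by_cases hi : Even i
  · have ho : Odd (i + 1) := hi.add_one
    have hsum := one_sub_X_pow_sq_mul_tsum (R := R) i
    have h2 : ∀ j : ℕ, tagWeight z (i + 1) (j + 1) • (X : R⟦X⟧) ^ ((i + 1) * (j + 1)) =
        C z * (((j + 1 : ℕ) : R) • (X : R⟦X⟧) ^ ((i + 1) * (j + 1))) := by
      intro j
      rw [tagWeight, if_pos ho, smul_eq_C_mul, smul_eq_C_mul, map_mul, mul_assoc]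
    have h3 : Summable fun j : ℕ => ((j + 1 : ℕ) : R) • (X : R⟦X⟧) ^ ((i + 1) * (j + 1)) :=
      Nat.Partition.summable_genFun_term (fun _ c => (c : R)) i
    simp only [h2, hi, if_true]
    rw [h3.tsum_mul_left]
    have hu : C (u : R) * C ((u⁻¹ : Rˣ) : R) = 1 := by rw [← map_mul]; simp
    have hzC : (C z : R⟦X⟧) = C (u : R) + C ((u⁻¹ : Rˣ) : R) + 2 := by
      rw [hz, map_add, map_add, map_ofNat]
    rw [hzC]
    linear_combination (C (u : R) + C ((u⁻¹ : Rˣ) : R) + 2) * hsum - (X ^ (i + 1)) ^ 2 * hu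
  · have ho : ¬ Odd (i + 1) := by
      rw [Nat.not_odd_iff_even]; exact (Nat.not_even_iff_odd.mp hi).add_one
    simp [tagWeight, ho, hi]

theorem genFun_tagWeight_mul_euler (u : Rˣ) (z : R) (hz : z = u + ((u⁻¹ : Rˣ) : R) + 2) :
    Nat.Partition.genFun (tagWeight z) * progProd (-1) 1 1 ^ 2 =
      progProd (-1) 2 2 * (progProd (-1) 2 2 * (progProd (u : R) 1 2 *
        progProd ((u⁻¹ : Rˣ) : R) 1 2)) := by
  rw [progProd_two (-1) 1 one_pos]
  linear_combination progProd (-1) 2 2 ^ 2 * genFun_tagWeight_mul u z hz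

end Counting

/-! ### The derivative at z = 1 and the first form of the PDO_t series -/

section Derivative

open TrivSqZeroExt

/-- The ε-part of (1 + δε)^k is kδ, so a partition with k part sizes is counted k times for each
choice of tags. -/
theorem sndSeries_genFun (δ : ℂ) :
    sndSeries (Nat.Partition.genFun (tagWeight (1 + inr δ : DualNumber ℂ))) =
      C δ * PowerSeries.map (Int.castRingHom ℂ) (PowerSeries.mk fun n => (PDOt n : ℤ)) := by
  ext n
  rw [coeff_sndSeries, Nat.Partition.coeff_genFun, coeff_C_mul, coeff_map, coeff_mk,
    PDOt_eq_sum_partitions, snd_sum]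
  rw [Nat.cast_sum, map_sum, Finset.mul_sum]
  refine Finset.sum_congr rfl fun p _ => ?_
  rw [prod_tagWeight]
  have hpow : ∀ k : ℕ, (1 + inr δ : DualNumber ℂ) ^ k = inl 1 + inr (k * δ) := by
    intro k
    induction k with
    | zero => simp
    | succ k ih =>
      rw [pow_succ, ih]
      ext
      · simp
      · simp; ring
  split_ifs with h
  · rw [hpow]
    generalize (∏ i ∈ p.parts.toFinset, p.parts.count i) = c
    have : ((c : ℕ) : DualNumber ℂ) = inl (c : ℂ) := by simp
    rw [this]
    simp
    ring
  · simp

/-- A primitive cube root of unity. -/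
theorem exists_cube_root : ∃ w : ℂˣ, (w : ℂ) ^ 2 + w + 1 = 0 := by
  have h := Complex.isPrimitiveRoot_exp 3 three_ne_zero
  set w := Complex.exp (2 * Real.pi * Complex.I / (3 : ℕ))
  have h1 : w ^ 3 = 1 := h.pow_eq_one
  have h2 : w ≠ 1 := h.ne_one (by norm_num)
  have h3 : w ≠ 0 := Complex.exp_ne_zero _
  refine ⟨Units.mk0 w h3, ?_⟩
  have : (w - 1) * (w ^ 2 + w + 1) = 0 := by linear_combination h1
  exact (mul_eq_zero.mp this).resolve_left (sub_ne_zero.mpr h2)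

theorem map_intCast_injective :
    Function.Injective (PowerSeries.map (Int.castRingHom ℂ)) := fun f g h => by
  ext n
  have := congrArg (coeff n) h
  simpa using this

theorem map_intCast_eulerProd {k : ℕ} (hk : 0 < k) :
    PowerSeries.map (Int.castRingHom ℂ) (eulerProd k) = progProd (-1) k k := by
  have := map_progProd (φ := Int.castRingHom ℂ) continuous_of_discreteTopology (-1) k hk
  simpa [eulerProd] using this

/-- Take ε-parts of the generating function at u = w(1+ε), for which u + u⁻¹ + 2 = 1 + (w - w²)ε. It
remains to evaluate ∑ n w^n q^(n²); the nonzero factor w - w² cancels and the identity descends from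
ℂ to ℤ. -/
theorem series_PDOt_mul : (PowerSeries.mk fun n => (PDOt n : ℤ)) * eulerProd 1 ^ 2 =
    eulerProd 2 * (X * expand 3 three_ne_zero quintupleSeries) := by
  obtain ⟨w, hw⟩ := exists_cube_root
  set δ : ℂ := w - w ^ 2 with hδ
  have hw3 : (w : ℂ) ^ 3 = 1 := by linear_combination ((w : ℂ) - 1) * hw
  have hδ0 : δ ≠ 0 := by
    intro h
    have : (w : ℂ) * (1 - w) = 0 := by rw [← h, hδ]; ring
    rcases mul_eq_zero.mp this with h1 | h1
    · exact w.ne_zero h1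
    · have h2 : (w : ℂ) = 1 := by linear_combination -h1
      rw [h2] at hw; norm_num at hw
  have hwu : w ^ 3 = 1 := Units.ext (by push_cast; exact hw3)
  have hwinv : ((w⁻¹ : ℂˣ) : ℂ) = w ^ 2 := by
    have : w⁻¹ = w ^ 2 := inv_eq_of_mul_eq_one_left (by rw [← pow_succ, hwu])
    rw [this]; push_cast; rfl
  have hz : (1 + inr δ : DualNumber ℂ) = dualLift w + (((dualLift w)⁻¹ : (DualNumber ℂ)ˣ) :
      DualNumber ℂ) + 2 := by
    have e1 := dualLift_zpow w 1
    have e2 := dualLift_zpow w (-1)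
    rw [zpow_one] at e1
    rw [zpow_neg_one] at e2
    rw [e1, e2, zpow_one, zpow_neg_one, hwinv, show (2 : DualNumber ℂ) = inl 2 from rfl]
    ext
    · simp only [fst_add, fst_inl, fst_inr, fst_one]
      linear_combination -hw
    · simp only [snd_add, snd_inl, snd_inr, snd_one, hδ]
      push_cast
      ring
  have h1 := congrArg sndSeries (genFun_tagWeight_mul_euler (dualLift w) _ hz)
  have h2 := hasSum_derivative_thetaTerm w 1 1 (k := 2) rfl two_pos
  set Θ := progProd (-1) 2 2 * (progProd ((dualLift w : (DualNumber ℂ)ˣ) : DualNumber ℂ) 1 2 *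
        progProd (((dualLift w)⁻¹ : (DualNumber ℂ)ˣ) : DualNumber ℂ) 1 2)
  rw [sq, sndSeries_mul, sndSeries_mul, sndSeries_mul, progProd_neg_one_dual, progProd_neg_one_dual,
    sndSeries_progProd_of_snd_eq_zero _ _ one_pos, sndSeries_progProd_of_snd_eq_zero _ _ two_pos,
    map_mul, map_fst_progProd _ _ one_pos, map_fst_progProd _ _ two_pos, sndSeries_genFun] at h1
  simp only [fst_inl, mul_zero, zero_mul, add_zero, zero_add] at h1
  have h3 : sndSeries Θ = C δ * PowerSeries.map (Int.castRingHom ℂ)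
      (X * expand 3 three_ne_zero quintupleSeries) := by
    have hq := (hasSum_quintupleTerm.map (expand 3 three_ne_zero : ℤ⟦X⟧ →ₐ[ℤ] ℤ⟦X⟧)
      (continuous_expand three_ne_zero)).mul_left X
    have hq2 := hq.map (PowerSeries.map (Int.castRingHom ℂ))
      (continuous_map continuous_of_discreteTopology)
    -- Reversing the index matches 3n+1 with -(3n-1), as used in the split of ℤ mod 3.
    rw [← (Equiv.neg ℤ).hasSum_iff] at hq2
    have hw3n : ∀ n : ℤ, w ^ (3 * n) = 1 := fun n => by
      rw [zpow_mul, zpow_ofNat, hwu, one_zpow]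
    set Q := PowerSeries.map (Int.castRingHom ℂ) (X * expand 3 three_ne_zero quintupleSeries)
    have hexp : ∀ n : ℤ, triangle (-(3 * n - 1)) + triangle (-(3 * n - 1) - 1) =
        3 * (5 * triangle (-n) + triangle (-n - 1)) + 1 := by
      intro n
      zify
      linarith [two_mul_triangle (-(3 * n - 1)), two_mul_triangle (-(3 * n - 1) - 1),
        two_mul_triangle (-n), two_mul_triangle (-n - 1)]
    have hexp' : ∀ n : ℤ, triangle (3 * n - 1) + triangle (3 * n - 1 - 1) =
        3 * (5 * triangle (-n) + triangle (-n - 1)) + 1 := by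
      intro n
      zify
      linarith [two_mul_triangle (3 * n - 1), two_mul_triangle (3 * n - 1 - 1),
        two_mul_triangle (-n), two_mul_triangle (-n - 1)]
    have hterm : ∀ n : ℤ, PowerSeries.map (Int.castRingHom ℂ)
        (X * expand 3 three_ne_zero (quintupleTerm (-n))) =
        C ((-(3 * n - 1) : ℤ) : ℂ) * X ^ (3 * (5 * triangle (-n) + triangle (-n - 1)) + 1) := by
      intro n
      have e : (((-(3 * n - 1) : ℤ)) : ℂ) = Int.castRingHom ℂ (3 * -n + 1) := by
        rw [eq_intCast]; congr 1; ring
      rw [e]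
      simp only [quintupleTerm, map_mul, map_pow, expand_C, expand_X, map_X, map_C, ← pow_mul, pow_add,
        pow_one, one_mul, mul_add]
      ring
    have hzero : HasSum (fun n : ℤ => (C (3 * n) * X ^ (9 * triangle n + 9 * triangle (n - 1)) :
        ℤ⟦X⟧)) 0 := by
      have hs := (OrderTendsto.of_finite (finite_theta_exponent_lt (i := 9) (j := 9) (by simp))
        fun n : ℤ => (C (3 * n) : ℤ⟦X⟧)).summable.hasSum
      have h0 := hs.eq_zero_of_antisymm (Equiv.neg ℤ) fun n => by
        rw [Equiv.neg_apply, ← neg_mul, ← map_neg]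
        congr 2
        · ring_nf
        · zify
          linarith [two_mul_triangle (-n), two_mul_triangle (-n - 1), two_mul_triangle n,
            two_mul_triangle (n - 1)]
      rwa [h0] at hs
    have hzero' := hzero.map (PowerSeries.map (Int.castRingHom ℂ))
      (continuous_map continuous_of_discreteTopology)
    rw [map_zero] at hzero'
    -- The indices 3n cancel in pairs; 3n-1 carries w² and -(3n-1) carries w, with opposite
    -- coefficients and equal exponents.
    have h4 : C δ * Q = 0 + (C (-(w : ℂ) ^ 2) * Q + C (w : ℂ) * Q) := by
      rw [hδ, map_sub, map_neg]; ring
    rw [h4]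
    refine h2.unique (HasSum.of_bijective_sumElim_three bijective_three_mul
      (HasSum.of_forall_eq hzero' fun n => ?_)
      (HasSum.of_forall_eq (HasSum.mul_left _ hq2) fun n => ?_)
      (HasSum.of_forall_eq (HasSum.mul_left _ hq2) fun n => ?_))
    · simp only [Function.comp, hw3n, map_mul, map_pow, map_X, map_C, Units.val_one, one_mul]
      congr 1
      · simp
      · congr 1
        zify
        linarith [two_mul_triangle (3 * n), two_mul_triangle (3 * n - 1), two_mul_triangle n,
            two_mul_triangle (n - 1)]
    · simp only [Function.comp, Equiv.neg_apply]
      rw [hterm, ← mul_assoc, ← map_mul]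
      have e : w ^ (3 * n - 1) = w ^ 2 := by
        rw [zpow_sub, hw3n, one_mul, zpow_one]
        exact inv_eq_of_mul_eq_one_left (by rw [← pow_succ, hwu])
      rw [e, one_mul, one_mul, hexp']
      congr 2
      push_cast
      ring
    · simp only [Function.comp, Equiv.neg_apply]
      rw [hterm, ← mul_assoc, ← map_mul]
      have e : w ^ (-(3 * n - 1)) = w := by
        rw [neg_sub, zpow_sub, hw3n, zpow_one, inv_one, mul_one]
      rw [e, one_mul, one_mul, hexp]
  rw [h3] at h1
  refine map_intCast_injective (mul_left_cancel₀ (a := (C δ : ℂ⟦X⟧)) ?_ ?_)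
  · exact fun h => hδ0 (by simpa using congrArg constantCoeff h)
  · simp only [map_mul, map_pow, map_intCast_eulerProd one_pos, map_intCast_eulerProd two_pos] at h1 ⊢
    linear_combination h1

end Derivative

/-! ### Norms over cube roots of unity and a cubic theta identity -/

section Norm

theorem expand_injective {R : Type*} [CommRing R] {n : ℕ} (hn : n ≠ 0) :
    Function.Injective (expand n hn : R⟦X⟧ →ₐ[R] R⟦X⟧) := fun f g h => by
  ext m
  have := congrArg (coeff (n * m)) h
  simpa [coeff_expand_mul] using this

theorem rescale_expand_of_pow_eq_one {R : Type*} [CommRing R] {n : ℕ} (hn : n ≠ 0) {a : R}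
    (ha : a ^ n = 1) (f : R⟦X⟧) : rescale a (expand n hn f) = expand n hn f := by
  ext m
  rw [coeff_rescale, coeff_expand]
  split_ifs with h
  · obtain ⟨k, rfl⟩ := h
    rw [pow_mul, ha, one_pow, one_mul]
  · rw [mul_zero]

/-- The product of a power series with its twists by the cube roots of unity. -/
noncomputable def cubicNorm (w : ℂ) (f : ℂ⟦X⟧) : ℂ⟦X⟧ := f * rescale w f * rescale (w ^ 2) f

theorem cubicNorm_mul (w : ℂ) (f g : ℂ⟦X⟧) :
    cubicNorm w (f * g) = cubicNorm w f * cubicNorm w g := by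
  simp only [cubicNorm, map_mul]; ring

/-- All exponents are ≡ i mod 3 and v = w^i is again a primitive cube root, so each factor has norm
(1-x)(1-vx)(1-v²x) = 1 - x³. -/
theorem cubicNorm_progProd {w : ℂ} (hw : w ^ 2 + w + 1 = 0) {i k : ℕ} (hi : ¬ 3 ∣ i) (hk : 0 < k)
    (hk3 : 3 ∣ k) : cubicNorm w (progProd (-1) i k) = progProd (-1) (3 * i) (3 * k) := by
  have hw3 : w ^ 3 = 1 := by linear_combination (w - 1) * hw
  obtain ⟨l, rfl⟩ := hk3
  have h1 : w ^ (3 * l) = 1 := by rw [pow_mul, hw3, one_pow]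
  have h2 : (w ^ 2) ^ (3 * l) = 1 := by rw [← pow_mul, mul_comm, pow_mul, h1, one_pow]
  rw [cubicNorm, rescale_progProd _ _ _ hk h1, rescale_progProd _ _ _ hk h2]
  set v := w ^ i
  have hv : v ^ 2 + v + 1 = 0 := by
    have h4 : i = 3 * (i / 3) + i % 3 := (Nat.div_add_mod i 3).symm
    have h3 : v = w ^ (i % 3) := by
      simp only [v]
      conv_lhs => rw [h4]
      rw [pow_add, pow_mul, hw3, one_pow, one_mul]
    have h5 : i % 3 = 1 ∨ i % 3 = 2 := by omega
    rcases h5 with h | h <;> rw [h3, h]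
    · linear_combination hw
    · linear_combination (w ^ 2 - w + 1) * hw
  have hv2 : (w ^ 2) ^ i = v ^ 2 := by simp only [v, ← pow_mul, mul_comm]
  rw [hv2]
  refine (((hasProd_progProd _ i hk).mul (hasProd_progProd _ i hk)).mul
    (hasProd_progProd _ i hk)).unique ?_
  refine HasProd.of_forall_eq (hasProd_progProd (-1) (3 * i) (Nat.mul_pos three_pos hk)) fun m => ?_
  have e : 3 * i + 3 * (3 * l) * m = (i + 3 * l * m) * 3 := by ring
  rw [e, pow_mul]
  generalize (X : ℂ⟦X⟧) ^ (i + 3 * l * m) = x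
  have hC : (C v ^ 2 + C v + 1 : ℂ⟦X⟧) = 0 := by
    rw [← map_pow, ← map_one C, ← map_add, ← map_add, hv, map_zero]
  simp only [map_mul, map_neg, map_one, map_pow]
  linear_combination (-x + C v * x ^ 2 - x ^ 3 * (C v - 1)) * hC

/-- Split f_k by residues mod 3: the multiples of 3 form f_{3k}, which is invariant and gets cubed,
while the other two classes have norm f_{3k}/f_{9k}. -/
theorem cubicNorm_euler {w : ℂ} (hw : w ^ 2 + w + 1 = 0) {k : ℕ} (hk : ¬ 3 ∣ k) (hk0 : 0 < k) :
    cubicNorm w (progProd (-1) k k) * progProd (-1) (9 * k) (9 * k) =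
      progProd (-1) (3 * k) (3 * k) ^ 4 := by
  have hw3 : w ^ 3 = 1 := by linear_combination (w - 1) * hw
  have h1 := progProd_three (-1 : ℂ) k hk0
  have h2 := progProd_three (-1 : ℂ) (3 * k) (Nat.mul_pos three_pos hk0)
  have h3 : cubicNorm w (progProd (-1) (3 * k) (3 * k)) = progProd (-1) (3 * k) (3 * k) ^ 3 := by
    have h4 : progProd (-1 : ℂ) (3 * k) (3 * k) = expand 3 three_ne_zero (progProd (-1) k k) :=
      (expand_progProd _ _ hk0 _).symm
    rw [h4, cubicNorm, rescale_expand_of_pow_eq_one _ hw3,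
      rescale_expand_of_pow_eq_one _ (by rw [← pow_mul, mul_comm, pow_mul, hw3, one_pow])]
    ring
  have e1 : k + k * 2 = 3 * k := by ring
  have e2 : 3 * k + 3 * k = 3 * (k + k) := by ring
  have e3 : 3 * k + 3 * k * 2 = 9 * k := by ring
  have e4 : 3 * (3 * k) = 9 * k := by ring
  rw [e1] at h1
  rw [e2, e3, e4] at h2
  rw [h1, cubicNorm_mul, cubicNorm_mul, h3, cubicNorm_progProd hw hk (by omega) (by simp),
    cubicNorm_progProd hw (by omega) (by omega) (by simp), e4, pow_succ _ 3]
  nth_rw 3 [h2]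
  ring

theorem cubicNorm_sub {w : ℂ} (hw : w ^ 2 + w + 1 = 0) (f g : ℂ⟦X⟧) :
    cubicNorm w (expand 3 three_ne_zero f - 2 * X * expand 3 three_ne_zero g) =
      expand 3 three_ne_zero (f ^ 3 - 8 * X * g ^ 3) := by
  have hw3 : w ^ 3 = 1 := by linear_combination (w - 1) * hw
  have hw6 : (w ^ 2) ^ 3 = 1 := by rw [← pow_mul, mul_comm, pow_mul, hw3, one_pow]
  simp only [cubicNorm, map_sub, map_mul, map_ofNat, rescale_expand_of_pow_eq_one _ hw3, map_pow,
    rescale_expand_of_pow_eq_one _ hw6, rescale_X, expand_X]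
  have hC : (C w ^ 2 + C w + 1 : ℂ⟦X⟧) = 0 := by
    rw [← map_pow, ← map_one C, ← map_add, ← map_add, hw, map_zero]
  generalize expand 3 three_ne_zero f = a
  generalize expand 3 three_ne_zero g = b
  linear_combination (-2 * X * a ^ 2 * b + 4 * X ^ 2 * C w * a * b ^ 2 -
    8 * X ^ 3 * b ^ 3 * (C w - 1)) * hC

/-- Take the norm of φ(-q) = f_1²/f_2 in two ways: from its 3-dissection it is a³ - (2qb)³, from the
Euler products it is f_3⁸ f_18/(f_9² f_6⁴). Then replace q³ by q. -/
theorem theta_cube_sub_theta_cube :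
    (theta (-1) 3 3 ^ 3 - 8 * X * theta (-1) 1 5 ^ 3) * (eulerProd 2 ^ 4 * eulerProd 3 ^ 2) =
      eulerProd 1 ^ 8 * eulerProd 6 := by
  obtain ⟨w, hw⟩ := exists_cube_root
  obtain ⟨φ, hφ⟩ : ∃ φ : ℤ⟦X⟧ →+* ℂ⟦X⟧, φ = PowerSeries.map (Int.castRingHom ℂ) := ⟨_, rfl⟩
  have hinj : Function.Injective φ := hφ ▸ map_intCast_injective
  have hX : φ X = X := by rw [hφ, map_X]
  have hexp : ∀ f, φ (expand 3 three_ne_zero f) = expand 3 three_ne_zero (φ f) := by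
    rw [hφ]
    exact fun f => map_expand 3 three_ne_zero _ f
  have hE : ∀ {k : ℕ}, 0 < k → φ (eulerProd k) = progProd (-1) k k := by
    rw [hφ]
    exact map_intCast_eulerProd
  have h9 : theta (-1) 9 9 = expand 3 three_ne_zero (theta (-1) 3 3) := by
    rw [expand_theta (-1) (by simp)]
  have h15 : theta (-1) 3 15 = expand 3 three_ne_zero (theta (-1) 1 5) := by
    rw [expand_theta (-1) (by simp)]
  have h1 := theta_neg_one_one_one
  rw [theta_neg_one_eq_three_dissection, h9, h15] at h1
  have h2 := congrArg (fun f => cubicNorm w (φ f)) h1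
  simp only [map_mul, map_sub, map_ofNat, hexp, sq, cubicNorm_mul, hE one_pos, hE two_pos]
    at h2
  rw [hX, cubicNorm_sub hw] at h2
  have n1 := cubicNorm_euler hw (k := 1) (by norm_num) (by norm_num)
  have n2 := cubicNorm_euler hw (k := 2) (by norm_num) (by norm_num)
  simp only [mul_one, Nat.reduceMul] at n1 n2
  have hEE : ∀ {k : ℕ}, 0 < k →
      φ (expand 3 three_ne_zero (eulerProd k)) = progProd (-1) (3 * k) (3 * k) := fun hk => by
    rw [expand_eulerProd hk, hE (Nat.mul_pos three_pos hk)]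
  have e1 := hEE one_pos
  have e2 := hEE two_pos
  have e3 := hEE three_pos
  have e6 := hEE (k := 6) (by norm_num)
  simp only [mul_one, Nat.reduceMul] at e1 e2 e3 e6
  refine expand_injective three_ne_zero (hinj ?_)
  have e0 : φ (expand 3 three_ne_zero (theta (-1) 3 3 ^ 3 - 8 * X * theta (-1) 1 5 ^ 3)) =
      expand 3 three_ne_zero (φ (theta (-1) 3 3) ^ 3 - 8 * X * φ (theta (-1) 1 5) ^ 3) := by
    rw [hexp]
    simp only [map_sub, map_mul, map_pow, map_ofNat]
    rw [hX]
  simp only [map_mul _ (_ - _), e0, map_mul, map_pow, e1, e2, e3, e6]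
  generalize expand 3 three_ne_zero (φ (theta (-1) 3 3) ^ 3 - 8 * X * φ (theta (-1) 1 5) ^ 3) = N at *
  generalize cubicNorm w (progProd (-1) 1 1) = N1 at *
  generalize cubicNorm w (progProd (-1) 2 2) = N2 at *
  generalize progProd (-1 : ℂ) 3 3 = F3 at *
  generalize progProd (-1 : ℂ) 9 9 = F9 at *
  generalize progProd (-1 : ℂ) 6 6 = F6 at *
  generalize progProd (-1 : ℂ) 18 18 = F18 at *
  linear_combination F9 ^ 2 * F18 * h2 - N * F9 ^ 2 * n2 + F18 * (N1 * F9 + F3 ^ 4) * n1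

end Norm

theorem series_PDOt_mul_eulerProd :
    (PowerSeries.mk fun n => (PDOt n : ℤ)) * (eulerProd 1 ^ 2 * eulerProd 6) =
      X * (eulerProd 2 * eulerProd 3 ^ 2 * eulerProd 12 ^ 2) := by
  have h1 := series_PDOt_mul
  have h2 : theta (-1) 1 1 * eulerProd 4 ^ 2 = quintupleSeries := by
    refine mul_left_cancel₀ (eulerProd_ne_zero four_pos) ?_
    linear_combination theta_neg_one_mul_eulerProd_four_cube
  have h3 := congrArg (expand 3 three_ne_zero) h2
  have h4 := congrArg (expand 3 three_ne_zero) theta_neg_one_one_one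
  simp only [map_mul, map_pow] at h3 h4
  rw [expand_theta _ (by simp), expand_eulerProd four_pos] at h3
  rw [expand_theta _ (by simp), expand_eulerProd two_pos, expand_eulerProd one_pos] at h4
  norm_num at h3 h4
  rw [← h3] at h1
  linear_combination eulerProd 6 * h1 + eulerProd 2 * X * eulerProd 12 ^ 2 * h4

/-! ### Euler quotients and 2-dissection in the field of fractions -/

/-- The field of fractions of the ring of formal power series over the integers. -/
abbrev SeriesField : Type := FractionRing ℤ⟦X⟧

namespace SeriesField

/-- The embedding of the formal power series into their field of fractions. -/
noncomputable def of : ℤ⟦X⟧ →+* SeriesField := algebraMap ℤ⟦X⟧ (FractionRing ℤ⟦X⟧)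

theorem of_injective : Function.Injective of := IsFractionRing.injective ℤ⟦X⟧ (FractionRing ℤ⟦X⟧)

/-- The variable. -/
noncomputable def q : SeriesField := of X

/-- The Euler products. -/
noncomputable def f (k : ℕ) : SeriesField := of (eulerProd k)

theorem q_ne_zero : q ≠ 0 := (map_ne_zero_iff _ of_injective).2 X_ne_zero

theorem f_ne_zero {k : ℕ} (hk : 0 < k) : f k ≠ 0 :=
  (map_ne_zero_iff _ of_injective).2 (eulerProd_ne_zero hk)

theorem exists_of_div (x : SeriesField) : ∃ a b : ℤ⟦X⟧, b ≠ 0 ∧ x = of a / of b := by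
  obtain ⟨a, b, hb, h⟩ := IsFractionRing.div_surjective (A := ℤ⟦X⟧) x
  exact ⟨a, b, nonZeroDivisors.ne_zero hb, h.symm⟩

/-- The substitution of a power of the variable. -/
noncomputable def sub (n : ℕ) (hn : n ≠ 0) : SeriesField →+* SeriesField :=
  IsFractionRing.map (j := (expand n hn : ℤ⟦X⟧ →ₐ[ℤ] ℤ⟦X⟧).toRingHom) (expand_injective hn)

theorem sub_of (n : ℕ) (hn : n ≠ 0) (a : ℤ⟦X⟧) : sub n hn (of a) = of (expand n hn a) := by
  rw [sub, IsFractionRing.map, of]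
  exact IsLocalization.map_eq _ a

theorem sub_q (n : ℕ) (hn : n ≠ 0) : sub n hn q = q ^ n := by
  rw [q, sub_of, expand_X, map_pow]

theorem sub_f (n : ℕ) (hn : n ≠ 0) {k : ℕ} (hk : 0 < k) : sub n hn (f k) = f (n * k) := by
  rw [f, sub_of, expand_eulerProd hk, f]

end SeriesField

theorem mk_eq_expand_two_add (c : ℕ → ℤ) :
    PowerSeries.mk c = expand 2 two_ne_zero (PowerSeries.mk fun n => c (2 * n)) +
      X * expand 2 two_ne_zero (PowerSeries.mk fun n => c (2 * n + 1)) := by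
  ext n
  rw [coeff_mk, map_add]
  obtain ⟨k, rfl | rfl⟩ := n.even_or_odd'
  · rw [coeff_expand_mul, coeff_mk]
    cases k with
    | zero => simp
    | succ k =>
      rw [show 2 * (k + 1) = 2 * k + 1 + 1 by ring, coeff_succ_X_mul,
        coeff_expand, if_neg (by omega), add_zero]
  · rw [coeff_succ_X_mul, coeff_expand_mul, coeff_mk, coeff_expand, if_neg (by omega), zero_add]

theorem eq_zero_of_expand_two_add_eq_zero {a b : ℤ⟦X⟧}
    (h : expand 2 two_ne_zero a + X * expand 2 two_ne_zero b = 0) : a = 0 ∧ b = 0 := by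
  refine ⟨?_, ?_⟩ <;> ext k
  · have := congrArg (coeff (2 * k)) h
    rw [map_add, coeff_expand_mul] at this
    cases k with
    | zero => simpa using this
    | succ k =>
      rwa [show 2 * (k + 1) = 2 * k + 1 + 1 by ring, coeff_succ_X_mul,
        coeff_expand, if_neg (by omega), add_zero] at this
  · have := congrArg (coeff (2 * k + 1)) h
    rwa [map_add, coeff_succ_X_mul, coeff_expand_mul, coeff_expand, if_neg (by omega),
      zero_add] at this

namespace SeriesField

/-- After clearing the denominators, which are series in q², this is the separation of even and odd
exponents. -/
theorem eq_zero_of_sub_two_add_eq_zero {x y : SeriesField}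
    (h : sub 2 two_ne_zero x + q * sub 2 two_ne_zero y = 0) : x = 0 ∧ y = 0 := by
  obtain ⟨a, b, hb, rfl⟩ := exists_of_div x
  obtain ⟨c, d, hd, rfl⟩ := exists_of_div y
  have hb' : of (expand 2 two_ne_zero b) ≠ 0 := by
    rw [← sub_of]
    exact (map_ne_zero _).2 ((map_ne_zero_iff _ of_injective).2 hb)
  have hd' : of (expand 2 two_ne_zero d) ≠ 0 := by
    rw [← sub_of]
    exact (map_ne_zero _).2 ((map_ne_zero_iff _ of_injective).2 hd)
  rw [map_div₀, map_div₀, sub_of, sub_of, sub_of, sub_of] at h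
  have h1 : expand 2 two_ne_zero (a * d) + X * expand 2 two_ne_zero (c * b) = 0 := by
    apply of_injective
    rw [map_zero, map_add, map_mul of X]
    simp only [map_mul]
    rw [← q]
    field_simp at h
    linear_combination h
  obtain ⟨h2, h3⟩ := eq_zero_of_expand_two_add_eq_zero h1
  rw [mul_eq_zero, or_iff_left hd] at h2
  rw [mul_eq_zero, or_iff_left hb] at h3
  simp [h2, h3]

theorem of_mk_eq_of_eq_sub_two_add {c : ℕ → ℤ} {x y : SeriesField}
    (h : of (PowerSeries.mk c) = sub 2 two_ne_zero x + q * sub 2 two_ne_zero y) :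
    of (PowerSeries.mk fun n => c (2 * n)) = x ∧
      of (PowerSeries.mk fun n => c (2 * n + 1)) = y := by
  rw [mk_eq_expand_two_add, map_add, map_mul, ← sub_of, ← sub_of, ← q] at h
  have := eq_zero_of_sub_two_add_eq_zero
    (x := of (PowerSeries.mk fun n => c (2 * n)) - x)
    (y := of (PowerSeries.mk fun n => c (2 * n + 1)) - y)
    (by rw [map_sub, map_sub]; linear_combination h)
  exact ⟨sub_eq_zero.1 this.1, sub_eq_zero.1 this.2⟩

theorem of_theta_one_one_one : of (theta 1 1 1) = f 2 ^ 5 / (f 1 ^ 2 * f 4 ^ 2) := by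
  rw [eq_div_iff (by simp [f_ne_zero])]
  simpa only [f, map_mul, map_pow] using congrArg of _root_.theta_one_one_one

theorem of_theta_neg_one_one_one : of (theta (-1) 1 1) = f 1 ^ 2 / f 2 := by
  rw [eq_div_iff (by simp [f_ne_zero])]
  simpa only [f, map_mul, map_pow] using congrArg of _root_.theta_neg_one_one_one

theorem of_theta_one_one_zero : of (theta 1 1 0) = 2 * f 2 ^ 2 / f 1 := by
  rw [eq_div_iff (by simp [f_ne_zero])]
  simpa only [f, map_mul, map_pow, map_ofNat] using congrArg of _root_.theta_one_one_zero

theorem of_theta_one_one_two : of (theta 1 1 2) = f 2 * f 3 ^ 2 / (f 1 * f 6) := by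
  rw [eq_div_iff (by simp [f_ne_zero])]
  simpa only [f, map_mul, map_pow] using congrArg of _root_.theta_one_one_two

theorem of_theta_one_one_five :
    of (theta 1 1 5) = f 2 ^ 2 * f 3 * f 12 / (f 1 * f 4 * f 6) := by
  rw [eq_div_iff (by simp [f_ne_zero])]
  simpa only [f, map_mul, map_pow] using congrArg of _root_.theta_one_one_five

theorem of_theta_neg_one_one_five : of (theta (-1) 1 5) = f 1 * f 6 ^ 2 / (f 2 * f 3) := by
  rw [eq_div_iff (by simp [f_ne_zero])]
  simpa only [f, map_mul, map_pow] using congrArg of _root_.theta_neg_one_one_five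

theorem of_theta_mul (u : ℤˣ) {i j : ℕ} (h : 0 < i + j) (n : ℕ) (hn : n ≠ 0) :
    of (theta u (n * i) (n * j)) = sub n hn (of (theta u i j)) := by
  rw [sub_of, expand_theta u h hn]

end SeriesField

/-- Under q ↦ -q only the odd exponents change sign, and ∏ (1 + q^(2m+1)) = f_2²/(f_1 f_4). -/
theorem eulerProd_mul_rescale_eulerProd_one :
    eulerProd 1 * eulerProd 4 * rescale (-1) (eulerProd 1) = eulerProd 2 ^ 3 := by
  have r2 : rescale (-1 : ℤ) (eulerProd 2) = eulerProd 2 := by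
    simpa [expand_eulerProd] using
      rescale_expand_of_pow_eq_one two_ne_zero (a := (-1 : ℤ)) (by norm_num) (eulerProd 1)
  have h : rescale (-1) (eulerProd 1) = progProd 1 1 2 * eulerProd 2 := by
    rw [eulerProd_one_eq, map_mul, r2, rescale_progProd _ _ _ two_pos (by norm_num)]
    simp
  rw [h]
  linear_combination eulerProd 2 * eulerProd_mul_progProd_one_two

theorem eulerProd_mul_rescale_eulerProd_three :
    eulerProd 3 * eulerProd 12 * rescale (-1) (eulerProd 3) = eulerProd 6 ^ 3 := by
  have h := congrArg (expand 3 three_ne_zero) eulerProd_mul_rescale_eulerProd_one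
  have e : expand 3 three_ne_zero (rescale (-1) (eulerProd 1)) = rescale (-1) (eulerProd 3) := by
    rw [show eulerProd 3 = expand 3 three_ne_zero (eulerProd 1) by
      rw [expand_eulerProd one_pos, mul_one]]
    ext n
    rw [coeff_rescale, coeff_expand, coeff_expand]
    split_ifs with hn
    · obtain ⟨k, rfl⟩ := hn
      rw [Nat.mul_div_cancel_left _ three_pos, coeff_rescale, pow_mul]
      norm_num
    · rw [mul_zero]
  simpa [e, expand_eulerProd] using h

/-! ### The level twelve parametrization and the basic 2-dissections -/

namespace SeriesField

theorem ofNat_two_ne_zero : (2 : SeriesField) ≠ 0 := by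
  rw [← map_ofNat of]
  exact (map_ne_zero_iff _ of_injective).2 powerSeries_two_ne_zero

theorem of_eulerProd (k : ℕ) : of (eulerProd k) = f k := rfl

theorem of_X : of X = q := rfl

theorem of_theta_one_three_three : of (theta 1 3 3) = f 6 ^ 5 / (f 3 ^ 2 * f 12 ^ 2) := by
  simpa [of_theta_one_one_one, sub_f] using of_theta_mul 1 (i := 1) (j := 1) (by simp) 3 (by simp)

theorem of_theta_neg_one_three_three : of (theta (-1) 3 3) = f 3 ^ 2 / f 6 := by
  simpa [of_theta_neg_one_one_one, sub_f] using
    of_theta_mul (-1) (i := 1) (j := 1) (by simp) 3 (by simp)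

theorem of_theta_neg_one_four_four : of (theta (-1) 4 4) = f 4 ^ 2 / f 8 := by
  simpa [of_theta_neg_one_one_one, sub_f] using
    of_theta_mul (-1) (i := 1) (j := 1) (by simp) 4 (by simp)

theorem of_theta_neg_one_twelve_twelve : of (theta (-1) 12 12) = f 12 ^ 2 / f 24 := by
  simpa [of_theta_neg_one_one_one, sub_f] using
    of_theta_mul (-1) (i := 1) (j := 1) (by simp) 12 (by simp)

theorem of_theta_one_two_two : of (theta 1 2 2) = f 4 ^ 5 / (f 2 ^ 2 * f 8 ^ 2) := by
  simpa [of_theta_one_one_one, sub_f] using of_theta_mul 1 (i := 1) (j := 1) (by simp) 2 (by simp)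

theorem of_theta_one_four_four : of (theta 1 4 4) = f 8 ^ 5 / (f 4 ^ 2 * f 16 ^ 2) := by
  simpa [of_theta_one_one_one, sub_f] using of_theta_mul 1 (i := 1) (j := 1) (by simp) 4 (by simp)

theorem of_theta_one_two_four : of (theta 1 2 4) = f 4 * f 6 ^ 2 / (f 2 * f 12) := by
  simpa [of_theta_one_one_two, sub_f] using of_theta_mul 1 (i := 1) (j := 2) (by simp) 2 (by simp)

theorem of_theta_one_mul_zero {n : ℕ} (hn : n ≠ 0) :
    of (theta 1 n 0) = 2 * f (n * 2) ^ 2 / f n := by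
  simpa [of_theta_one_one_zero, sub_f, map_ofNat (sub n hn) 2] using
    of_theta_mul 1 (i := 1) (j := 0) (by simp) n hn

theorem one_div_f_one_sq : 1 / f 1 ^ 2 =
    f 8 ^ 5 / (f 2 ^ 5 * f 16 ^ 2) + 2 * q * (f 4 ^ 2 * f 16 ^ 2 / (f 2 ^ 5 * f 8)) := by
  have h := congrArg of theta_one_eq_two_dissection
  rw [map_add, map_mul, of_theta_one_one_one, of_theta_one_four_four,
    of_theta_one_mul_zero (by norm_num), ← q] at h
  have h1 := f_ne_zero one_pos
  have h2 := f_ne_zero two_pos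
  have h4 := f_ne_zero four_pos
  have h8 := f_ne_zero (k := 8) (by norm_num)
  have h16 := f_ne_zero (k := 16) (by norm_num)
  have e : 1 / f 1 ^ 2 = f 2 ^ 5 / (f 1 ^ 2 * f 4 ^ 2) * (f 4 ^ 2 / f 2 ^ 5) := by field_simp
  rw [e, h]
  field_simp

/-- 1/f_1⁴ is φ(q)² times a series in q², so its dissection is that of φ(q)²; 1/f_1² is obtained
from φ(q) in the same way. -/
theorem one_div_f_one_pow_four : 1 / f 1 ^ 4 =
    f 4 ^ 14 / (f 2 ^ 14 * f 8 ^ 4) + 4 * q * (f 4 ^ 2 * f 8 ^ 4 / f 2 ^ 10) := by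
  have h := congrArg of theta_sq_eq
  rw [map_add, map_mul, map_pow, map_pow, map_pow, of_theta_one_one_one, of_theta_one_two_two,
    of_theta_one_mul_zero (by norm_num), ← q] at h
  have h1 := f_ne_zero one_pos
  have h2 := f_ne_zero two_pos
  have h4 := f_ne_zero four_pos
  have h8 := f_ne_zero (k := 8) (by norm_num)
  have e : 1 / f 1 ^ 4 = (f 2 ^ 5 / (f 1 ^ 2 * f 4 ^ 2)) ^ 2 * (f 4 ^ 4 / f 2 ^ 10) := by field_simp
  rw [e, h]
  field_simp
  ring

/-- φ(q)⁴ - φ(-q)⁴ = 16qψ(q²)⁴: the squares φ(±q)² are a ± b, and the difference of their squares is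
4ab. -/
theorem jacobi_theta_relation :
    f 2 ^ 20 / (f 1 ^ 8 * f 4 ^ 8) - f 1 ^ 8 / f 2 ^ 4 = 16 * q * (f 4 ^ 8 / f 2 ^ 4) := by
  have h := congrArg of theta_sq_eq
  have h' := congrArg of theta_neg_one_sq_eq
  rw [map_add, map_mul, map_pow, map_pow, map_pow, of_theta_one_one_one, of_theta_one_two_two,
    of_theta_one_mul_zero (by norm_num), ← q] at h
  rw [map_sub, map_mul, map_pow, map_pow, map_pow, of_theta_neg_one_one_one, of_theta_one_two_two,
    of_theta_one_mul_zero (by norm_num), ← q] at h'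
  have h1 := f_ne_zero one_pos
  have h2 := f_ne_zero two_pos
  have h4 := f_ne_zero four_pos
  have h8 := f_ne_zero (k := 8) (by norm_num)
  have e : f 2 ^ 20 / (f 1 ^ 8 * f 4 ^ 8) = ((f 2 ^ 5 / (f 1 ^ 2 * f 4 ^ 2)) ^ 2) ^ 2 := by
    field_simp
  have e' : f 1 ^ 8 / f 2 ^ 4 = ((f 1 ^ 2 / f 2) ^ 2) ^ 2 := by field_simp
  rw [e, e', h, h']
  field_simp
  ring

/-- The parameter of level twelve in terms of which the other quotients are expressed. -/
noncomputable def levelP : SeriesField :=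
  2 * q * (f 2 ^ 3 * f 3 ^ 3 * f 12 ^ 6 / (f 1 * f 4 ^ 2 * f 6 ^ 9))

theorem levelE_eq :
    f 2 ^ 3 * f 3 ^ 6 * f 12 ^ 3 / (f 1 ^ 2 * f 4 * f 6 ^ 9) = 1 + levelP := by
  have h := congrArg of theta_one_two_sq
  rw [map_add, map_mul, map_mul, map_mul, map_pow, of_theta_one_one_two, of_theta_one_two_four,
    of_theta_one_three_three, of_theta_one_one_five, of_theta_one_mul_zero (by norm_num), ← q] at h
  have h1 := f_ne_zero one_pos
  have h2 := f_ne_zero two_pos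
  have h3 := f_ne_zero three_pos
  have h4 := f_ne_zero four_pos
  have h6 := f_ne_zero (k := 6) (by norm_num)
  have h12 := f_ne_zero (k := 12) (by norm_num)
  have e : f 2 ^ 3 * f 3 ^ 6 * f 12 ^ 3 / (f 1 ^ 2 * f 4 * f 6 ^ 9) =
      (f 2 * f 3 ^ 2 / (f 1 * f 6)) ^ 2 * (f 2 * f 3 ^ 2 * f 12 ^ 3 / (f 4 * f 6 ^ 7)) := by
    field_simp
  rw [e, h, levelP]
  field_simp

/-- Normalized, the cubic theta identity reads G² = E² - 4P, and E = 1+P. -/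
theorem levelG_sq : (f 1 ^ 2 * f 2 * f 3 ^ 2 * f 12 ^ 3 / (f 4 * f 6 ^ 7)) ^ 2 =
    (1 - levelP) ^ 2 := by
  have h := congrArg of theta_cube_sub_theta_cube
  simp only [map_mul, map_sub, map_pow, of_theta_neg_one_three_three, of_theta_neg_one_one_five,
    map_ofNat, of_eulerProd, of_X] at h
  have h1 := f_ne_zero one_pos
  have h2 := f_ne_zero two_pos
  have h3 := f_ne_zero three_pos
  have h4 := f_ne_zero four_pos
  have h6 := f_ne_zero (k := 6) (by norm_num)
  have h12 := f_ne_zero (k := 12) (by norm_num)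
  have e : (f 1 ^ 2 * f 2 * f 3 ^ 2 * f 12 ^ 3 / (f 4 * f 6 ^ 7)) ^ 2 =
      (f 1 ^ 8 * f 6) * (f 2 ^ 2 * f 3 ^ 4 * f 12 ^ 6 / (f 1 ^ 4 * f 4 ^ 2 * f 6 ^ 15)) := by
    field_simp
  have e' : (1 - levelP) ^ 2 =
      (f 2 ^ 3 * f 3 ^ 6 * f 12 ^ 3 / (f 1 ^ 2 * f 4 * f 6 ^ 9)) ^ 2 - 4 * levelP := by
    rw [levelE_eq]; ring
  rw [e, ← h, e', levelP]
  field_simp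
  ring

/-- The sign of the square root is decided by constant terms: the other root would give 1 = -1. -/
theorem levelG_eq : f 1 ^ 2 * f 2 * f 3 ^ 2 * f 12 ^ 3 / (f 4 * f 6 ^ 7) = 1 - levelP := by
  refine (sq_eq_sq_iff_eq_or_eq_neg.1 levelG_sq).resolve_right fun h => ?_
  rw [levelP] at h
  have h1 := f_ne_zero one_pos
  have h4 := f_ne_zero four_pos
  have h6 := f_ne_zero (k := 6) (by norm_num)
  have e : f 1 ^ 3 * f 2 * f 3 ^ 2 * f 12 ^ 3 * f 4 * f 6 ^ 2 =
      2 * q * (f 2 ^ 3 * f 3 ^ 3 * f 12 ^ 6) - f 1 * f 4 ^ 2 * f 6 ^ 9 := by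
    field_simp at h
    linear_combination h
  simp only [f, q, ← map_mul, ← map_pow, ← map_ofNat of, ← map_sub] at e
  have := congrArg constantCoeff (of_injective e)
  simp [eulerProd, constantCoeff_progProd] at this

theorem levelM_eq_add :
    f 2 ^ 10 * f 3 ^ 4 * f 12 ^ 4 / (f 1 ^ 4 * f 4 ^ 4 * f 6 ^ 10) =
      (1 + levelP) * (1 - levelP) +
        levelP * (2 * (f 4 ^ 2 * f 2 * f 3 ^ 3 * f 12 ^ 2 / (f 1 * f 6 ^ 7))) := by
  have h := congrArg of theta_one_three_sub
  simp only [map_mul, map_sub, of_theta_neg_one_three_three, of_theta_one_one_one,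
    of_theta_one_three_three, of_theta_neg_one_one_one, of_X] at h
  rw [of_theta_one_mul_zero (by norm_num), of_theta_one_mul_zero (by norm_num)] at h
  have h1 := f_ne_zero one_pos
  have h2 := f_ne_zero two_pos
  have h3 := f_ne_zero three_pos
  have h4 := f_ne_zero four_pos
  have h6 := f_ne_zero (k := 6) (by norm_num)
  have h12 := f_ne_zero (k := 12) (by norm_num)
  have e : f 2 ^ 10 * f 3 ^ 4 * f 12 ^ 4 / (f 1 ^ 4 * f 4 ^ 4 * f 6 ^ 10) =
      f 2 ^ 5 / (f 1 ^ 2 * f 4 ^ 2) * (f 6 ^ 5 / (f 3 ^ 2 * f 12 ^ 2)) *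
        (f 2 ^ 5 * f 3 ^ 6 * f 12 ^ 6 / (f 1 ^ 2 * f 4 ^ 2 * f 6 ^ 15)) := by
    field_simp
  rw [e, eq_add_of_sub_eq h, ← levelE_eq, ← levelG_eq, levelP]
  field_simp
  ring

/-- Jacobi's quartic relation at q³, normalized: M = E³G + P³H. `levelM_eq_add` is M = EG + PH, from
φ(q)φ(q³) - φ(-q)φ(-q³); together they determine H and then M. -/
theorem levelM_eq_add_cube :
    f 2 ^ 10 * f 3 ^ 4 * f 12 ^ 4 / (f 1 ^ 4 * f 4 ^ 4 * f 6 ^ 10) =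
      (1 + levelP) ^ 3 * (1 - levelP) +
        levelP ^ 3 * (2 * (f 4 ^ 2 * f 2 * f 3 ^ 3 * f 12 ^ 2 / (f 1 * f 6 ^ 7))) := by
  have h := congrArg (sub 3 three_ne_zero) jacobi_theta_relation
  simp only [map_mul, map_sub, map_div₀, map_pow, map_ofNat, sub_q, sub_f _ _ one_pos,
    sub_f _ _ two_pos, sub_f _ _ four_pos, Nat.reduceMul, mul_one] at h
  have h1 := f_ne_zero one_pos
  have h2 := f_ne_zero two_pos
  have h3 := f_ne_zero three_pos
  have h4 := f_ne_zero four_pos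
  have h6 := f_ne_zero (k := 6) (by norm_num)
  have h12 := f_ne_zero (k := 12) (by norm_num)
  have e : f 2 ^ 10 * f 3 ^ 4 * f 12 ^ 4 / (f 1 ^ 4 * f 4 ^ 4 * f 6 ^ 10) =
      f 6 ^ 20 / (f 3 ^ 8 * f 12 ^ 8) *
        (f 2 ^ 10 * f 3 ^ 12 * f 12 ^ 12 / (f 1 ^ 4 * f 4 ^ 4 * f 6 ^ 30)) := by
    field_simp
  rw [e, eq_add_of_sub_eq h, ← levelE_eq, ← levelG_eq, levelP]
  field_simp
  ring

theorem levelP_ne_zero : levelP ≠ 0 := by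
  rw [levelP]
  simp [q_ne_zero, f_ne_zero, ofNat_two_ne_zero]

theorem one_add_levelP_ne_zero : 1 + levelP ≠ 0 := by
  rw [← levelE_eq]
  simp [f_ne_zero]

theorem one_sub_levelP_ne_zero : 1 - levelP ≠ 0 := by
  rw [← levelG_eq]
  simp [f_ne_zero]

/-- Equating the two expressions for M gives P(1-P²)H = P(1-P²)(2+P), and the factor P(1+P)(1-P) is
nonzero. -/
theorem levelH_eq : 2 * (f 4 ^ 2 * f 2 * f 3 ^ 3 * f 12 ^ 2 / (f 1 * f 6 ^ 7)) = 2 + levelP := by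
  have h := levelM_eq_add.symm.trans levelM_eq_add_cube
  refine mul_left_cancel₀ levelP_ne_zero (mul_left_cancel₀ one_add_levelP_ne_zero
    (mul_left_cancel₀ one_sub_levelP_ne_zero ?_))
  linear_combination h

theorem levelM_eq :
    f 2 ^ 10 * f 3 ^ 4 * f 12 ^ 4 / (f 1 ^ 4 * f 4 ^ 4 * f 6 ^ 10) = 1 + 2 * levelP := by
  rw [levelM_eq_add, levelH_eq]
  ring

/-- The relation 2E = H + P, that is 2(1+P) = (2+P) + P, multiplied by an Euler quotient. -/
theorem f_three_cube_div_f_one : f 3 ^ 3 / f 1 =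
    f 4 ^ 3 * f 6 ^ 2 / (f 2 ^ 2 * f 12) + q * (f 12 ^ 3 / f 4) := by
  have h1 := f_ne_zero one_pos
  have h2 := f_ne_zero two_pos
  have h3 := f_ne_zero three_pos
  have h4 := f_ne_zero four_pos
  have h6 := f_ne_zero (k := 6) (by norm_num)
  have h12 := f_ne_zero (k := 12) (by norm_num)
  have h := levelE_eq
  have hp := levelH_eq
  have e : f 3 ^ 3 / f 1 = f 2 ^ 3 * f 3 ^ 6 * f 12 ^ 3 / (f 1 ^ 2 * f 4 * f 6 ^ 9) *
    (f 1 * f 4 * f 6 ^ 9 / (f 2 ^ 3 * f 3 ^ 3 * f 12 ^ 3)) := by field_simp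
  have k : (1 + levelP) * 2 =
      2 * (f 4 ^ 2 * f 2 * f 3 ^ 3 * f 12 ^ 2 / (f 1 * f 6 ^ 7)) + levelP := by rw [hp]; ring
  have k' : 1 + levelP =
      f 4 ^ 2 * f 2 * f 3 ^ 3 * f 12 ^ 2 / (f 1 * f 6 ^ 7) +
        q * (f 2 ^ 3 * f 3 ^ 3 * f 12 ^ 6 / (f 1 * f 4 ^ 2 * f 6 ^ 9)) := by
    refine mul_right_cancel₀ ofNat_two_ne_zero (k.trans ?_)
    rw [levelP]
    ring
  rw [e, h, k']
  field_simp

/-- The relation 2M = H + 3P, that is 2(1+2P) = (2+P) + 3P, multiplied by an Euler quotient. -/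
theorem f_three_div_f_one_cube : f 3 / f 1 ^ 3 =
    f 4 ^ 6 * f 6 ^ 3 / (f 2 ^ 9 * f 12 ^ 2) +
      3 * q * (f 4 ^ 2 * f 6 * f 12 ^ 2 / f 2 ^ 7) := by
  have h1 := f_ne_zero one_pos
  have h2 := f_ne_zero two_pos
  have h3 := f_ne_zero three_pos
  have h4 := f_ne_zero four_pos
  have h6 := f_ne_zero (k := 6) (by norm_num)
  have h12 := f_ne_zero (k := 12) (by norm_num)
  have e : f 3 / f 1 ^ 3 = f 2 ^ 10 * f 3 ^ 4 * f 12 ^ 4 / (f 1 ^ 4 * f 4 ^ 4 * f 6 ^ 10) *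
    (f 1 * f 4 ^ 4 * f 6 ^ 10 / (f 2 ^ 10 * f 3 ^ 3 * f 12 ^ 4)) := by field_simp
  have k' : 1 + 2 * levelP =
      f 4 ^ 2 * f 2 * f 3 ^ 3 * f 12 ^ 2 / (f 1 * f 6 ^ 7) +
        3 * q * (f 2 ^ 3 * f 3 ^ 3 * f 12 ^ 6 / (f 1 * f 4 ^ 2 * f 6 ^ 9)) := by
    have hp := levelH_eq
    refine mul_right_cancel₀ ofNat_two_ne_zero ?_
    have hP : levelP = 2 * q * (f 2 ^ 3 * f 3 ^ 3 * f 12 ^ 6 / (f 1 * f 4 ^ 2 * f 6 ^ 9)) := rfl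
    linear_combination 3 * hP - hp
  rw [e, levelM_eq, k']
  field_simp

theorem of_rescale_hexagonalSeries :
    of (rescale (-1) hexagonalSeries) = 2 * (f 1 * f 3 * f 4 * f 12 / (f 2 * f 6)) := by
  have h1 := congrArg of eulerProd_mul_rescale_eulerProd_one
  have h3 := congrArg of eulerProd_mul_rescale_eulerProd_three
  simp only [map_mul, map_pow, of_eulerProd] at h1 h3
  have h : eulerProd 1 * eulerProd 3 * hexagonalSeries = 2 * eulerProd 2 ^ 2 * eulerProd 6 ^ 2 := by
    have := theta_one_one_zero
    have h0 := theta_mul_theta_eq_two_mul_hexagonalSeries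
    have h5 := congrArg (expand 3 three_ne_zero) theta_one_one_zero
    rw [map_mul, map_mul, map_pow, map_ofNat, expand_theta _ (by simp), expand_eulerProd one_pos,
      expand_eulerProd two_pos] at h5
    refine mul_left_cancel₀ powerSeries_two_ne_zero ?_
    simp only [mul_one, mul_zero, Nat.reduceMul] at h5
    linear_combination (-eulerProd 1 * eulerProd 3) * h0 + eulerProd 3 * theta 1 3 0 * this +
      2 * eulerProd 2 ^ 2 * h5
  have h' := congrArg (fun g => of (rescale (-1) g)) h
  have r2 : rescale (-1 : ℤ) (eulerProd 2) = eulerProd 2 := by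
    simpa [expand_eulerProd] using
      rescale_expand_of_pow_eq_one two_ne_zero (a := (-1 : ℤ)) (by norm_num) (eulerProd 1)
  have r6 : rescale (-1 : ℤ) (eulerProd 6) = eulerProd 6 := by
    simpa [expand_eulerProd] using
      rescale_expand_of_pow_eq_one two_ne_zero (a := (-1 : ℤ)) (by norm_num) (eulerProd 3)
  simp only [map_mul, map_pow, map_ofNat, r2, r6, of_eulerProd] at h'
  have n2 := f_ne_zero two_pos
  have n6 := f_ne_zero (k := 6) (by norm_num)
  rw [← mul_div_assoc, eq_div_iff (mul_ne_zero n2 n6)]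
  refine mul_left_cancel₀ (mul_ne_zero (pow_ne_zero 2 n2) (pow_ne_zero 2 n6)) ?_
  generalize of (rescale (-1) (eulerProd 1)) = s1 at *
  generalize of (rescale (-1) (eulerProd 3)) = s3 at *
  generalize of (rescale (-1) hexagonalSeries) = s at *
  linear_combination (-s * f 3 * f 12 * s3) * h1 - s * f 2 ^ 3 * h3 +
    f 1 * f 3 * f 4 * f 12 * h'

/-- Up to a series in q² this is φ(q)φ(-q³), whose parity split is known. -/
theorem f_three_sq_div_f_one_sq : f 3 ^ 2 / f 1 ^ 2 =
    f 4 ^ 4 * f 6 * f 12 ^ 2 / (f 2 ^ 5 * f 8 * f 24) +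
      2 * q * (f 4 * f 6 ^ 2 * f 8 * f 24 / (f 2 ^ 4 * f 12)) := by
  have h := congrArg of theta_one_mul_theta_neg_three
  rw [map_add, map_mul, map_mul, map_mul, of_theta_one_one_one, of_theta_neg_one_three_three,
    of_theta_neg_one_four_four, of_theta_neg_one_twelve_twelve, ← sub_of, of_X,
    of_rescale_hexagonalSeries] at h
  simp only [map_mul, map_div₀, map_ofNat, sub_f _ _ one_pos, sub_f _ _ two_pos,
    sub_f _ _ three_pos, sub_f _ _ four_pos, sub_f 2 two_ne_zero (k := 6) (by norm_num),
    sub_f 2 two_ne_zero (k := 12) (by norm_num), Nat.reduceMul, mul_one] at h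
  have h1 := f_ne_zero one_pos
  have h2 := f_ne_zero two_pos
  have h4 := f_ne_zero four_pos
  have h6 := f_ne_zero (k := 6) (by norm_num)
  have h8 := f_ne_zero (k := 8) (by norm_num)
  have h12 := f_ne_zero (k := 12) (by norm_num)
  have h24 := f_ne_zero (k := 24) (by norm_num)
  have e : f 3 ^ 2 / f 1 ^ 2 = f 2 ^ 5 / (f 1 ^ 2 * f 4 ^ 2) * (f 3 ^ 2 / f 6) *
    (f 4 ^ 2 * f 6 / f 2 ^ 5) := by field_simp
  rw [e, h]
  field_simp

end SeriesField

/-! ### Successive 2-dissection of the PDO_t series -/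

namespace SeriesField

theorem sub_two_f (k : ℕ) [NeZero k] : sub 2 two_ne_zero (f k) = f (2 * k) :=
  sub_f 2 two_ne_zero (NeZero.pos k)

theorem of_mk_PDOt : of (PowerSeries.mk fun n => (PDOt n : ℤ)) =
    q * (f 2 * f 3 ^ 2 * f 12 ^ 2 / (f 1 ^ 2 * f 6)) := by
  have h := congrArg of series_PDOt_mul_eulerProd
  simp only [map_mul, map_pow, of_eulerProd, of_X] at h
  rw [← mul_div_assoc, eq_div_iff (by simp [f_ne_zero])]
  exact h

theorem of_mk_PDOt_two_mul :
    of (PowerSeries.mk fun n => (PDOt (2 * n) : ℤ)) =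
      2 * q * (f 2 * f 3 * f 4 * f 6 * f 12 / f 1 ^ 3) ∧
    of (PowerSeries.mk fun n => (PDOt (2 * n + 1) : ℤ)) =
      f 2 ^ 4 * f 6 ^ 4 / (f 1 ^ 4 * f 4 * f 12) := by
  refine of_mk_eq_of_eq_sub_two_add (c := fun n => (PDOt n : ℤ)) ?_
  simp only [map_mul, map_div₀, map_pow, map_ofNat, sub_q, sub_two_f, Nat.reduceMul, mul_one]
  have h1 := f_ne_zero one_pos
  have h2 := f_ne_zero two_pos
  have h4 := f_ne_zero four_pos
  have h6 := f_ne_zero (k := 6) (by norm_num)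
  have h8 := f_ne_zero (k := 8) (by norm_num)
  have h12 := f_ne_zero (k := 12) (by norm_num)
  have h24 := f_ne_zero (k := 24) (by norm_num)
  have e : q * (f 2 * f 3 ^ 2 * f 12 ^ 2 / (f 1 ^ 2 * f 6)) =
      q * (f 2 * f 12 ^ 2 / f 6) * (f 3 ^ 2 / f 1 ^ 2) := by field_simp
  rw [of_mk_PDOt, e, f_three_sq_div_f_one_sq]
  field_simp
  ring

theorem of_mk_PDOt_four_mul_add_three :
    of (PowerSeries.mk fun n => (PDOt (2 * (2 * n + 1) + 1) : ℤ)) =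
      4 * (f 2 * f 3 ^ 4 * f 4 ^ 4 / (f 1 ^ 6 * f 6)) := by
  -- The value of `x` is the discarded even part; uniqueness needs both halves.
  refine (of_mk_eq_of_eq_sub_two_add (c := fun n => (PDOt (2 * n + 1) : ℤ))
    (x := f 2 ^ 10 * f 3 ^ 4 / (f 1 ^ 10 * f 4 ^ 4) * (f 2 ^ 3 / f 6)) ?_).2
  simp only [map_mul, map_div₀, map_pow, map_ofNat, sub_two_f, Nat.reduceMul, mul_one]
  have h1 := f_ne_zero one_pos
  have h2 := f_ne_zero two_pos
  have h4 := f_ne_zero four_pos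
  have h8 := f_ne_zero (k := 8) (by norm_num)
  have h12 := f_ne_zero (k := 12) (by norm_num)
  have e : f 2 ^ 4 * f 6 ^ 4 / (f 1 ^ 4 * f 4 * f 12) =
      f 2 ^ 4 * f 6 ^ 4 / (f 4 * f 12) * (1 / f 1 ^ 4) := by field_simp
  rw [of_mk_PDOt_two_mul.2, e, one_div_f_one_pow_four]
  field_simp

theorem of_mk_PDOt_four_mul_add_two :
    of (PowerSeries.mk fun n => (PDOt (2 * (2 * n + 1)) : ℤ)) =
      2 * (f 2 ^ 7 * f 3 ^ 4 / (f 1 ^ 8 * f 6)) := by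
  refine (of_mk_eq_of_eq_sub_two_add (c := fun n => (PDOt (2 * n) : ℤ))
    (x := 6 * q * (f 2 ^ 3 * f 3 ^ 2 * f 6 ^ 3 / f 1 ^ 6)) ?_).2
  simp only [map_mul, map_div₀, map_pow, map_ofNat, sub_q, sub_two_f, Nat.reduceMul, mul_one]
  have h1 := f_ne_zero one_pos
  have h2 := f_ne_zero two_pos
  have h4 := f_ne_zero four_pos
  have h8 := f_ne_zero (k := 8) (by norm_num)
  have h12 := f_ne_zero (k := 12) (by norm_num)
  have e : 2 * q * (f 2 * f 3 * f 4 * f 6 * f 12 / f 1 ^ 3) =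
      2 * q * (f 2 * f 4 * f 6 * f 12) * (f 3 / f 1 ^ 3) := by field_simp
  rw [of_mk_PDOt_two_mul.1, e, f_three_div_f_one_cube]
  field_simp
  ring

/-- `1 + 3 u`, where `u` is the quotient `levelP / ((1 + 2 levelP) (2 + levelP))`. -/
theorem one_add_three_mul_level_quotient :
    f 4 ^ 2 * f 2 * f 3 ^ 3 * f 12 ^ 2 / (f 1 * f 6 ^ 7) *
        (1 + 3 * q * (f 1 ^ 4 * f 6 ^ 8 / (f 2 ^ 8 * f 3 ^ 4))) =
      1 + 4 * q * (f 1 ^ 2 * f 3 ^ 2 * f 4 ^ 4 * f 12 ^ 4 / (f 2 ^ 6 * f 6 ^ 6)) := by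
  have hm := levelM_eq
  have hh := levelH_eq
  have h1 := f_ne_zero one_pos
  have h2 := f_ne_zero two_pos
  have h3 := f_ne_zero three_pos
  have h4 := f_ne_zero four_pos
  have h6 := f_ne_zero (k := 6) (by norm_num)
  have h12 := f_ne_zero (k := 12) (by norm_num)
  set m := f 2 ^ 10 * f 3 ^ 4 * f 12 ^ 4 / (f 1 ^ 4 * f 4 ^ 4 * f 6 ^ 10) with em
  set h := f 4 ^ 2 * f 2 * f 3 ^ 3 * f 12 ^ 2 / (f 1 * f 6 ^ 7) with eh
  have hm0 : m ≠ 0 := by simp [em, f_ne_zero]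
  have hh0 : h ≠ 0 := by simp [eh, f_ne_zero]
  -- With m = 1+2P and 2h = 2+P both sides become (1 + 4P + P²)/(1+2P).
  have hu : q * (f 1 ^ 4 * f 6 ^ 8 / (f 2 ^ 8 * f 3 ^ 4)) * (m * (2 * h)) = levelP := by
    rw [em, eh, levelP]; field_simp
  have hv : 4 * q * (f 1 ^ 2 * f 3 ^ 2 * f 4 ^ 4 * f 12 ^ 4 / (f 2 ^ 6 * f 6 ^ 6)) * m =
      levelP * (2 * h) := by
    rw [em, eh, levelP]; field_simp; ring
  refine mul_left_cancel₀ ofNat_two_ne_zero (mul_right_cancel₀ hm0 ?_)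
  rw [hm, hh] at hu
  rw [hm, hh] at hv
  rw [hm]
  linear_combination (1 + 2 * levelP) *
    (1 + 3 * (q * (f 1 ^ 4 * f 6 ^ 8 / (f 2 ^ 8 * f 3 ^ 4)))) * hh + 3 * hu - 2 * hv

/-- In terms of P: 2(1-P²)/(2+P) = 1 - P(1+2P)/(2+P). -/
theorem one_sub_level_quotient :
    f 1 * f 2 ^ 3 * f 3 ^ 5 * f 12 ^ 4 / (f 4 ^ 4 * f 6 ^ 9) =
      1 - q * (f 2 ^ 12 * f 3 ^ 4 * f 12 ^ 8 / (f 1 ^ 4 * f 4 ^ 8 * f 6 ^ 12)) := by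
  have hm := levelM_eq
  have hh := levelH_eq
  have he := levelE_eq
  have hg := levelG_eq
  have h1 := f_ne_zero one_pos
  have h2 := f_ne_zero two_pos
  have h3 := f_ne_zero three_pos
  have h4 := f_ne_zero four_pos
  have h6 := f_ne_zero (k := 6) (by norm_num)
  have h12 := f_ne_zero (k := 12) (by norm_num)
  set m := f 2 ^ 10 * f 3 ^ 4 * f 12 ^ 4 / (f 1 ^ 4 * f 4 ^ 4 * f 6 ^ 10) with em
  set h := f 4 ^ 2 * f 2 * f 3 ^ 3 * f 12 ^ 2 / (f 1 * f 6 ^ 7) with eh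
  have hh0 : h ≠ 0 := by simp [eh, f_ne_zero]
  have hu : f 1 * f 2 ^ 3 * f 3 ^ 5 * f 12 ^ 4 / (f 4 ^ 4 * f 6 ^ 9) * h =
      (1 + levelP) * (1 - levelP) := by
    rw [eh, ← he, ← hg]; field_simp
  have hv : q * (f 2 ^ 12 * f 3 ^ 4 * f 12 ^ 8 / (f 1 ^ 4 * f 4 ^ 8 * f 6 ^ 12)) * (2 * h) =
      levelP * m := by
    rw [em, eh, levelP]; field_simp
  refine mul_left_cancel₀ ofNat_two_ne_zero (mul_right_cancel₀ hh0 ?_)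
  rw [hm] at hv
  linear_combination 2 * hu + hv - hh

/-- In terms of P: (1-P²)/(1+2P) = 1 - P(2+P)/(1+2P). -/
theorem one_sub_four_mul_level_quotient :
    f 1 ^ 4 * f 3 ^ 4 * f 4 ^ 2 * f 12 ^ 2 / (f 2 ^ 6 * f 6 ^ 6) =
      1 - 4 * q * (f 1 ^ 2 * f 3 ^ 2 * f 4 ^ 4 * f 12 ^ 4 / (f 2 ^ 6 * f 6 ^ 6)) := by
  have hm := levelM_eq_add
  have he := levelE_eq
  have hg := levelG_eq
  have h1 := f_ne_zero one_pos
  have h2 := f_ne_zero two_pos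
  have h3 := f_ne_zero three_pos
  have h4 := f_ne_zero four_pos
  have h6 := f_ne_zero (k := 6) (by norm_num)
  have h12 := f_ne_zero (k := 12) (by norm_num)
  rw [← he, ← hg] at hm
  set m := f 2 ^ 10 * f 3 ^ 4 * f 12 ^ 4 / (f 1 ^ 4 * f 4 ^ 4 * f 6 ^ 10) with em
  set h := f 4 ^ 2 * f 2 * f 3 ^ 3 * f 12 ^ 2 / (f 1 * f 6 ^ 7) with eh
  have hm0 : m ≠ 0 := by simp [em, f_ne_zero]
  have hu : f 1 ^ 4 * f 3 ^ 4 * f 4 ^ 2 * f 12 ^ 2 / (f 2 ^ 6 * f 6 ^ 6) * m =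
      f 2 ^ 3 * f 3 ^ 6 * f 12 ^ 3 / (f 1 ^ 2 * f 4 * f 6 ^ 9) *
        (f 1 ^ 2 * f 2 * f 3 ^ 2 * f 12 ^ 3 / (f 4 * f 6 ^ 7)) := by
    rw [em]; field_simp
  have hv : 4 * q * (f 1 ^ 2 * f 3 ^ 2 * f 4 ^ 4 * f 12 ^ 4 / (f 2 ^ 6 * f 6 ^ 6)) * m =
      levelP * (2 * h) := by
    rw [em, eh, levelP]; field_simp; ring
  refine mul_right_cancel₀ hm0 ?_
  linear_combination hu - hm + hv

/-- Multiply the dissections A+qB of f_3³/f_1, C+3qD of f_3/f_1³ and U+2qV of 1/f_1², all in q².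
Since AD = BC, the odd part is 4ADU + 2ACV(1+3u) with u = q²BD/(AC), and after q² ↦ q the last
factor is rewritten by `one_add_three_mul_level_quotient`. -/
theorem of_mk_PDOt_eight_mul_add_seven :
    of (PowerSeries.mk fun n => (PDOt (8 * n + 7) : ℤ)) =
      8 * (f 2 ^ 14 * f 3 * f 6 ^ 4 * f 8 ^ 2 / (f 1 ^ 14 * f 4 ^ 3 * f 12 ^ 2) +
        2 * (f 2 ^ 9 * f 3 ^ 2 * f 4 ^ 5 * f 6 / (f 1 ^ 13 * f 8 ^ 2)) +
        4 * q * (f 2 ^ 8 * f 3 ^ 3 * f 4 * f 8 ^ 2 * f 12 ^ 2 / (f 1 ^ 12 * f 6 ^ 2))) := by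
  have h1 := f_ne_zero one_pos
  have h2 := f_ne_zero two_pos
  have h3 := f_ne_zero three_pos
  have h4 := f_ne_zero four_pos
  have h6 := f_ne_zero (k := 6) (by norm_num)
  have h8 := f_ne_zero (k := 8) (by norm_num)
  have h12 := f_ne_zero (k := 12) (by norm_num)
  have h24 := f_ne_zero (k := 24) (by norm_num)
  have h16 := f_ne_zero (k := 16) (by norm_num)
  have key := (of_mk_eq_of_eq_sub_two_add
    (c := fun n => (PDOt (2 * (2 * n + 1) + 1) : ℤ))
    (x := 4 * (f 1 * f 2 ^ 4 / f 3) *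
      ((f 2 ^ 3 * f 3 ^ 2 / (f 1 ^ 2 * f 6)) * (f 2 ^ 6 * f 3 ^ 3 / (f 1 ^ 9 * f 6 ^ 2)) *
          (f 4 ^ 5 / (f 1 ^ 5 * f 8 ^ 2)) +
        3 * q * (f 6 ^ 3 / f 2) * (f 2 ^ 2 * f 3 * f 6 ^ 2 / f 1 ^ 7) *
          (f 4 ^ 5 / (f 1 ^ 5 * f 8 ^ 2)) +
        2 * q * (f 6 ^ 3 / f 2) * (f 2 ^ 6 * f 3 ^ 3 / (f 1 ^ 9 * f 6 ^ 2)) *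
          (f 2 ^ 2 * f 8 ^ 2 / (f 1 ^ 5 * f 4)) +
        6 * q * (f 2 ^ 3 * f 3 ^ 2 / (f 1 ^ 2 * f 6)) * (f 2 ^ 2 * f 3 * f 6 ^ 2 / f 1 ^ 7) *
          (f 2 ^ 2 * f 8 ^ 2 / (f 1 ^ 5 * f 4))))
    (y := 16 * (f 2 ^ 9 * f 3 ^ 2 * f 4 ^ 5 * f 6 / (f 1 ^ 13 * f 8 ^ 2)) +
      8 * (f 2 ^ 14 * f 3 * f 6 ^ 4 * f 8 ^ 2 / (f 1 ^ 14 * f 4 ^ 3 * f 12 ^ 2) *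
        (f 4 ^ 2 * f 2 * f 3 ^ 3 * f 12 ^ 2 / (f 1 * f 6 ^ 7) *
          (1 + 3 * q * (f 1 ^ 4 * f 6 ^ 8 / (f 2 ^ 8 * f 3 ^ 4)))))) ?_).2
  · have e : (fun n => (PDOt (8 * n + 7) : ℤ)) =
        fun n => (PDOt (2 * (2 * (2 * n + 1) + 1) + 1) : ℤ) := by
      funext n; congr 2; ring
    rw [e, key, one_add_three_mul_level_quotient]
    field_simp
    ring
  · have e : 4 * (f 2 * f 3 ^ 4 * f 4 ^ 4 / (f 1 ^ 6 * f 6)) =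
        4 * (f 2 * f 4 ^ 4 / f 6) * ((f 3 ^ 3 / f 1) * (f 3 / f 1 ^ 3) * (1 / f 1 ^ 2)) := by
      field_simp
    rw [of_mk_PDOt_four_mul_add_three, e, f_three_cube_div_f_one, f_three_div_f_one_cube,
      one_div_f_one_sq]
    simp only [map_add, map_mul, map_div₀, map_pow, map_one, map_ofNat, sub_q, sub_two_f,
      Nat.reduceMul, mul_one]
    field_simp
    ring

/-- As for 8n+7, with 1/f_1⁴ in place of 1/f_1². Measured against the first quotient of the answer,
the odd part is (1-r) + (1-4v)(1+4v) = 2 - r - 16v², where r and v are the two quotients subtracted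
in `one_sub_level_quotient` and (without the 4) `one_sub_four_mul_level_quotient`. -/
theorem of_mk_PDOt_eight_mul_add_six :
    of (PowerSeries.mk fun n => (PDOt (8 * n + 6) : ℤ)) =
      8 * (2 * (f 2 ^ 16 * f 6 ^ 10 / (f 1 ^ 17 * f 3 ^ 3 * f 12 ^ 4)) -
        q * (f 2 ^ 28 * f 3 * f 12 ^ 4 / (f 1 ^ 21 * f 6 ^ 2 * f 4 ^ 8)) -
        16 * q ^ 2 * (f 2 ^ 4 * f 3 * f 4 ^ 8 * f 12 ^ 4 / (f 1 ^ 13 * f 6 ^ 2))) := by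
  have h1 := f_ne_zero one_pos
  have h2 := f_ne_zero two_pos
  have h3 := f_ne_zero three_pos
  have h4 := f_ne_zero four_pos
  have h6 := f_ne_zero (k := 6) (by norm_num)
  have h8 := f_ne_zero (k := 8) (by norm_num)
  have h12 := f_ne_zero (k := 12) (by norm_num)
  have h24 := f_ne_zero (k := 24) (by norm_num)
  have key := (of_mk_eq_of_eq_sub_two_add
    (c := fun n => (PDOt (2 * (2 * n + 1)) : ℤ))
    (x := 2 * (f 1 ^ 7 / f 3) *
      ((f 2 ^ 3 * f 3 ^ 2 / (f 1 ^ 2 * f 6)) * (f 2 ^ 6 * f 3 ^ 3 / (f 1 ^ 9 * f 6 ^ 2)) *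
          (f 2 ^ 14 / (f 1 ^ 14 * f 4 ^ 4)) +
        3 * q * (f 6 ^ 3 / f 2) * (f 2 ^ 2 * f 3 * f 6 ^ 2 / f 1 ^ 7) *
          (f 2 ^ 14 / (f 1 ^ 14 * f 4 ^ 4)) +
        4 * q * (f 6 ^ 3 / f 2) * (f 2 ^ 6 * f 3 ^ 3 / (f 1 ^ 9 * f 6 ^ 2)) *
          (f 2 ^ 2 * f 4 ^ 4 / f 1 ^ 10) +
        12 * q * (f 2 ^ 3 * f 3 ^ 2 / (f 1 ^ 2 * f 6)) * (f 2 ^ 2 * f 3 * f 6 ^ 2 / f 1 ^ 7) *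
          (f 2 ^ 2 * f 4 ^ 4 / f 1 ^ 10)))
    (y := 8 * (f 2 ^ 16 * f 6 ^ 10 / (f 1 ^ 17 * f 3 ^ 3 * f 12 ^ 4)) *
      (f 1 * f 2 ^ 3 * f 3 ^ 5 * f 12 ^ 4 / (f 4 ^ 4 * f 6 ^ 9) +
        f 1 ^ 4 * f 3 ^ 4 * f 4 ^ 2 * f 12 ^ 2 / (f 2 ^ 6 * f 6 ^ 6) *
        (f 4 ^ 2 * f 2 * f 3 ^ 3 * f 12 ^ 2 / (f 1 * f 6 ^ 7) *
          (1 + 3 * q * (f 1 ^ 4 * f 6 ^ 8 / (f 2 ^ 8 * f 3 ^ 4)))))) ?_).2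
  · have e : (fun n => (PDOt (8 * n + 6) : ℤ)) =
        fun n => (PDOt (2 * (2 * (2 * n + 1) + 1)) : ℤ) := by
      funext n; congr 2; ring
    rw [e, key, one_add_three_mul_level_quotient, one_sub_level_quotient,
      one_sub_four_mul_level_quotient]
    field_simp
    ring
  · have e : 2 * (f 2 ^ 7 * f 3 ^ 4 / (f 1 ^ 8 * f 6)) =
        2 * (f 2 ^ 7 / f 6) * ((f 3 ^ 3 / f 1) * (f 3 / f 1 ^ 3) * (1 / f 1 ^ 4)) := by
      field_simp
    rw [of_mk_PDOt_four_mul_add_two, e, f_three_cube_div_f_one, f_three_div_f_one_cube,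
      one_div_f_one_pow_four]
    simp only [map_add, map_mul, map_div₀, map_pow, map_one, map_ofNat, sub_q, sub_two_f,
      Nat.reduceMul, mul_one]
    field_simp
    ring

/-! ### Return to integer power series, and the congruences -/

/-- The value in the field of fractions of an invertible power series. -/
noncomputable def unitHom : ℤ⟦X⟧ˣ →* SeriesField :=
  of.toMonoidHom.comp (Units.coeHom ℤ⟦X⟧)

theorem of_coe_units (u : ℤ⟦X⟧ˣ) : of u = unitHom u := rfl

theorem unitHom_div (u v : ℤ⟦X⟧ˣ) : unitHom (u / v) = unitHom u / unitHom v :=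
  map_div' unitHom (fun a => by
    refine eq_inv_of_mul_eq_one_left ?_
    rw [← map_mul, inv_mul_cancel, map_one]) u v

theorem unitHom_eulerF (k : ℕ+) : unitHom (eulerF k) = f k := by
  rw [← of_coe_units, coe_eulerF, eulerSeries_eq_progProd, f, eulerProd]

end SeriesField

theorem modEq_zero_of_mk_eq_eight_mul {c : ℕ → ℕ} {g : ℤ⟦X⟧}
    (h : PowerSeries.mk (fun n => (c n : ℤ)) = 8 * g) (n : ℕ) : c n ≡ 0 [MOD 8] := by
  have h1 := congrArg (coeff n) h
  rw [coeff_mk, ← map_ofNat C, coeff_C_mul] at h1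
  refine (Nat.modEq_zero_iff_dvd).2 ?_
  exact_mod_cast Dvd.intro _ h1.symm


theorem theorem1p1 :
    (PowerSeries.mk (fun n : ℕ => (PDOt (8 * n + 6) : ℤ)) =
      8 * (2 * ((f[2] ^ 16 * f[6] ^ 10 / (f[1] ^ 17 * f[3] ^ 3 * f[12] ^ 4) : ℤ⟦X⟧ˣ) : ℤ⟦X⟧)
        - X * ((f[2] ^ 28 * f[3] * f[12] ^ 4 / (f[1] ^ 21 * f[6] ^ 2 * f[4] ^ 8) : ℤ⟦X⟧ˣ) : ℤ⟦X⟧)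
        - 16 * X ^ 2 *
          ((f[2] ^ 4 * f[3] * f[4] ^ 8 * f[12] ^ 4 / (f[1] ^ 13 * f[6] ^ 2) : ℤ⟦X⟧ˣ) : ℤ⟦X⟧))) ∧
    (PowerSeries.mk (fun n : ℕ => (PDOt (8 * n + 7) : ℤ)) =
      8 * (((f[2] ^ 14 * f[3] * f[6] ^ 4 * f[8] ^ 2 /
            (f[1] ^ 14 * f[4] ^ 3 * f[12] ^ 2) : ℤ⟦X⟧ˣ) : ℤ⟦X⟧)
        + 2 * ((f[2] ^ 9 * f[3] ^ 2 * f[4] ^ 5 * f[6] / (f[1] ^ 13 * f[8] ^ 2) : ℤ⟦X⟧ˣ) : ℤ⟦X⟧)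
        + 4 * X * ((f[2] ^ 8 * f[3] ^ 3 * f[4] * f[8] ^ 2 * f[12] ^ 2 /
            (f[1] ^ 12 * f[6] ^ 2) : ℤ⟦X⟧ˣ) : ℤ⟦X⟧))) ∧
    (∀ n : ℕ, PDOt (8 * n + 6) ≡ 0 [MOD 8]) ∧
    (∀ n : ℕ, PDOt (8 * n + 7) ≡ 0 [MOD 8]) := by
  refine (fun h6 h7 => ⟨h6, h7, modEq_zero_of_mk_eq_eight_mul h6,
    modEq_zero_of_mk_eq_eight_mul h7⟩) (SeriesField.of_injective ?_) (SeriesField.of_injective ?_)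
  · rw [SeriesField.of_mk_PDOt_eight_mul_add_six]
    simp only [map_mul, map_sub, map_pow, map_ofNat, SeriesField.of_X, SeriesField.of_coe_units,
      SeriesField.unitHom_div, SeriesField.unitHom_eulerF, PNat.val_ofNat]
  · rw [SeriesField.of_mk_PDOt_eight_mul_add_seven]
    simp only [map_mul, map_add, map_pow, map_ofNat, SeriesField.of_X, SeriesField.of_coe_units,
      SeriesField.unitHom_div, SeriesField.unitHom_eulerF, PNat.val_ofNat]
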